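/- Let $X$ be a connected, locally finite polygonal complex, that is, a 2-dimensional (piecewise spherical, Euclidean or hyperbolic) polyhedral complex: a CW-complex of dimension 2 whose open $n$-cells are isometric to interiors of compact convex polyhedra in $S^n$, $\mathbb{R}^n$ or $\mathbb{H}^n$ respectively (in the spherical case, contained in an open hemisphere), and such that the restriction of each attaching map to each open codimension-one face is an isometry onto an open cell of $X$. Let $V(X)$ and $F(X)$ be the sets of vertices and of 2-cells of $X$. Let $G=\mathrm{Aut}(X)$ be the group of polyhedral isometries of $X$, with the topology in which the pointwise stabilisers of combinatorial balls form a neighbourhood basis of the identity; here the ball $B(\sigma,0)$ is the closed cell $\sigma$, and $B(\sigma,k+1)$ is the union of the closed cells meeting $B(\sigma,k)$. Suppose that $G\backslash X$ is finite, i.e. $G$ has finitely many orbits of cells. A uniform lattice is a discrete subgroup $\Gamma\le G$ with $\Gamma\backslash G$ compact; $\Gamma$ acts without inversions if each of its elements fixes pointwise every cell that it preserves. For $S=V(X)$ or $S=F(X)$ put $\mathrm{Vol}(\Gamma\backslash\!\backslash S)=\sum_{s\in\Gamma\backslash S}1/|\Gamma_s|$. Then there is a left Haar measure $\mu$ on $G$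 normalised so that $\mu(\Gamma\backslash G)=\mathrm{Vol}(\Gamma\backslash\!\backslash V(X))$ for all uniform lattices $\Gamma\le G$, and there is a constant $c(X)>0$, depending only on $X$, such that for every such normalised $\mu$ and all uniform lattices $\Gamma\le G$ which act without inversions, $$\mu(\Gamma\backslash G)=c(X)\,\mathrm{Vol}(\Gamma\backslash\!\backslash F(X)).$$ -/

import Mathlib

open MeasureTheory
open scoped NNReal ENNReal

universe u v

namespace Polyhedral

/-! ### The model spaces of constant curvature -/

/-- The three model geometries of curvature `1`, `0`, `-1`. -/
inductive Geometry
  | spherical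
  | euclidean
  | hyperbolic

/-- The model space of dimension `n` inside `ℝ^(n+1)`: the unit sphere, the affine hyperplane
`x₀ = 1` (a copy of `ℝ^n`), or the upper sheet of the hyperboloid. -/
def modelSet : Geometry → (n : ℕ) → Set (Fin (n + 1) → ℝ)
  | .spherical, _ => {x | ∑ i, x i ^ 2 = 1}
  | .euclidean, _ => {x | x 0 = 1}
  | .hyperbolic, n => {x | 0 < x 0 ∧ -(x 0) ^ 2 + ∑ i : Fin n, x i.succ ^ 2 = -1}

/-- The model space `S^n`, `ℝ^n` or `ℍ^n` as a topological space. -/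
abbrev Model (κ : Geometry) (n : ℕ) : Type := ↥(modelSet κ n)

/-- The metric of constant curvature of the model space. -/
noncomputable def modelDist : (κ : Geometry) → {n : ℕ} → Model κ n → Model κ n → ℝ
  | .spherical, _, x, y => Real.arccos (∑ i, x.1 i * y.1 i)
  | .euclidean, n, x, y => Real.sqrt (∑ i : Fin n, (x.1 i.succ - y.1 i.succ) ^ 2)
  | .hyperbolic, n, x, y => Real.arcosh (x.1 0 * y.1 0 - ∑ i : Fin n, x.1 i.succ * y.1 i.succ)

variable {κ : Geometry}

/-- The (geodesic) convex hull of a finite set of points of the model space: the intersection of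
the model space with the convex cone spanned by these points. -/
def modelHull {n : ℕ} (S : Finset (Model κ n)) : Set (Model κ n) :=
  {x | ∃ w : Model κ n → ℝ, (∀ p ∈ S, 0 ≤ w p) ∧ x.1 = ∑ p ∈ S, w p • p.1}

/-- Compact convex polyhedra of full dimension `n`: convex hulls with non-empty interior of
finitely many points which, in the spherical case, lie in an open hemisphere (in the other two
geometries `x₀ > 0` on the model space, so that the condition with `ℓ` is automatic). -/
def IsConvexPolyhedron {n : ℕ} (P : Set (Model κ n)) : Prop :=
  ∃ S : Finset (Model κ n),
    (∃ ℓ : (Fin (n + 1) → ℝ) →ₗ[ℝ] ℝ, ∀ p ∈ S, 0 < ℓ p.1) ∧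
    P = modelHull S ∧ (interior P).Nonempty

/-- `F` is a closed face of codimension one of the `(n+1)`-dimensional polyhedron `P`: it is cut
out of `P` by a supporting totally geodesic hyperplane and has dimension `n`, that is, it spans a
linear subspace of dimension `n + 1` of `ℝ^(n+2)`. -/
def IsFacet {n : ℕ} (P F : Set (Model κ (n + 1))) : Prop :=
  ∃ ℓ : (Fin (n + 1 + 1) → ℝ) →ₗ[ℝ] ℝ, (∀ x ∈ P, 0 ≤ ℓ x.1) ∧
    F = {x | x ∈ P ∧ ℓ x.1 = 0} ∧
    Module.finrank ℝ (Submodule.span ℝ (Subtype.val '' F)) = n + 1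

/-- A distance preserving bijection between subsets of two model spaces (possibly of different
dimensions, as for a side of a polygon and an interval). -/
def IsIsom {m n : ℕ} {P : Set (Model κ m)} {Q : Set (Model κ n)} (e : P ≃ Q) : Prop :=
  ∀ x y : P, modelDist κ (e x).1 (e y).1 = modelDist κ x.1 y.1

end Polyhedral

open Polyhedral

/-! ### Polyhedral complexes -/

/-- A polyhedral complex (spherical, Euclidean or hyperbolic according to `κ`). The set `Point` of
points is the disjoint union of the open cells; every `n`-cell has a characteristic map from a
compact convex polyhedron in the model space of dimension `n`, which identifies the interior of the
polyhedron with the open cell and on every codimension one face is an isometry onto a cell of `X`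
(that is, it is the characteristic map of that cell up to an isometry of polyhedra).
Characteristic maps need not be injective on the boundary. -/
structure PolyhedralComplex (κ : Geometry) where
  /-- the points of the complex -/
  Point : Type u
  /-- the cells of each dimension -/
  Cell : ℕ → Type v
  /-- the polyhedron of a cell -/
  shape : ∀ {n : ℕ}, Cell n → Set (Model κ n)
  shape_isConvexPolyhedron : ∀ {n : ℕ} (σ : Cell n), IsConvexPolyhedron (shape σ)
  /-- the characteristic map of a cell -/
  charMap : ∀ {n : ℕ} (σ : Cell n), shape σ → Point
  bijective_charMap : Function.Bijective
    (fun y : (σ : (n : ℕ) × Cell n) × {x : shape σ.2 // x.1 ∈ interior (shape σ.2)} =>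
      charMap y.1.2 y.2.1)
  exists_facet_isom : ∀ {n : ℕ} (σ : Cell (n + 1)) (F : Set (Model κ (n + 1))),
    IsFacet (shape σ) F → ∃ (τ : Cell n) (e : F ≃ shape τ), IsIsom e ∧
      ∀ (x : F) (hx : x.1 ∈ shape σ), charMap σ ⟨x.1, hx⟩ = charMap τ (e x)

namespace PolyhedralComplex

variable {κ : Geometry} (X : PolyhedralComplex.{u, v} κ)

/-- The CW (weak) topology: the final topology for all the characteristic maps. -/
instance : TopologicalSpace X.Point :=
  ⨆ σ : (n : ℕ) × X.Cell n, TopologicalSpace.coinduced (X.charMap σ.2) inferInstance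

/-- The closed cell of `X` given by `σ`, as a set of points. -/
def closedCell {n : ℕ} (σ : X.Cell n) : Set X.Point := Set.range (X.charMap σ)

/-- Every point lies in finitely many closed cells only. -/
def IsLocallyFinite : Prop :=
  ∀ p : X.Point, {σ : (n : ℕ) × X.Cell n | p ∈ X.closedCell σ.2}.Finite

/-- A polygonal complex is a polyhedral complex of dimension exactly two. -/
def IsPolygonal : Prop :=
  Nonempty (X.Cell 2) ∧ ∀ n, 2 < n → IsEmpty (X.Cell n)

/-- The combinatorial ball `B(σ, k)`: `B(σ, 0)` is the closed cell `σ`, and `B(σ, k + 1)` is the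
union of the closed cells that meet `B(σ, k)`. -/
def ball {n : ℕ} (σ : X.Cell n) : ℕ → Set X.Point
  | 0 => X.closedCell σ
  | k + 1 => ⋃ τ ∈ {τ : (m : ℕ) × X.Cell m | (X.closedCell τ.2 ∩ ball σ k).Nonempty},
      X.closedCell τ.2

/-- The bijection `f` of the points carries the cell `σ` isometrically onto the cell `τ`. -/
def CarriesCell (f : X.Point → X.Point) {n : ℕ} (σ τ : X.Cell n) : Prop :=
  ∃ e : X.shape σ ≃ X.shape τ, IsIsom e ∧ ∀ x, f (X.charMap σ x) = X.charMap τ (e x)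

/-- The polyhedral isometries: bijections `f` of the points that carry every cell isometrically
onto a cell. The permutations `π` of the cells are recorded for convenience; they are
determined by `f`, since open cells are non-empty and pairwise disjoint. -/
def autSubgroup : Subgroup (Equiv.Perm X.Point × ((n : ℕ) → Equiv.Perm (X.Cell n))) where
  carrier := {a | ∀ (n : ℕ) (σ : X.Cell n), X.CarriesCell a.1 σ (a.2 n σ)}
  one_mem' := fun n σ => ⟨Equiv.refl _, fun _ _ => rfl, fun _ => rfl⟩
  mul_mem' := by
    rintro a b ha hb n σ
    obtain ⟨e, he, hf⟩ := hb n σ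
    obtain ⟨e', he', hf'⟩ := ha n (b.2 n σ)
    refine ⟨e.trans e', fun x y => (he' _ _).trans (he x y), fun x => ?_⟩
    exact (congrArg a.1 (hf x)).trans (hf' (e x))
  inv_mem' := by
    rintro a ha n σ
    obtain ⟨τ, rfl⟩ := (a.2 n).surjective σ
    have h : (a⁻¹).2 n (a.2 n τ) = τ := (a.2 n).symm_apply_apply τ
    rw [h]
    obtain ⟨e, he, hf⟩ := ha n τ
    refine ⟨e.symm, fun x y => ?_, fun x => ?_⟩
    · simpa using (he (e.symm x) (e.symm y)).symm
    · have := hf (e.symm x)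
      rw [Equiv.apply_symm_apply] at this
      rw [← this]
      exact a.1.symm_apply_apply _

/-- The group `Aut(X)` of polyhedral isometries of `X`. -/
def Aut : Type (max u v) := ↥X.autSubgroup

instance : Group X.Aut := inferInstanceAs (Group ↥X.autSubgroup)

instance : MulAction X.Aut X.Point where
  smul g p := g.1.1 p
  one_smul _ := rfl
  mul_smul _ _ _ := rfl

instance (n : ℕ) : MulAction X.Aut (X.Cell n) where
  smul g σ := g.1.2 n σ
  one_smul _ := rfl
  mul_smul _ _ _ := rfl

/-- The topology of `Aut(X)`, generated by the cosets of the pointwise stabilisers of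
combinatorial balls. -/
instance : TopologicalSpace X.Aut :=
  TopologicalSpace.generateFrom
    {U | ∃ (g : X.Aut) (n : ℕ) (σ : X.Cell n) (k : ℕ), U = {h | ∀ p ∈ X.ball σ k, h • p = g • p}}

instance : MeasurableSpace X.Aut := borel X.Aut

instance : BorelSpace X.Aut := ⟨rfl⟩

/-- The quotient of `X` by `Aut(X)` is finite: there are finitely many orbits of cells. -/
def HasFiniteQuotient : Prop :=
  ∀ n : ℕ, Finite (Quotient (MulAction.orbitRel X.Aut (X.Cell n)))

variable {X}

/-- A uniform lattice is a discrete subgroup `Γ` of `G = Aut(X)` with `Γ\G` compact. -/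
def IsUniformLattice (Γ : Subgroup X.Aut) : Prop :=
  DiscreteTopology Γ ∧ CompactSpace (Quotient (MulAction.orbitRel Γ X.Aut))

/-- Elements of `Γ` fix pointwise each cell that they preserve. -/
def ActsWithoutInversions (Γ : Subgroup X.Aut) : Prop :=
  ∀ g ∈ Γ, ∀ (n : ℕ) (σ : X.Cell n), g • σ = σ → ∀ p ∈ X.closedCell σ, g • p = p

/-- The `S`-covolume of `Γ`: the sum of `1 / |Γ_s|` over representatives `s` of `Γ\S`. -/
noncomputable def setCovolume (Γ : Subgroup X.Aut) (S : Type*) [MulAction X.Aut S] : ℝ≥0∞ :=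
  ∑' q : Quotient (MulAction.orbitRel Γ S),
    ((ENat.card (MulAction.stabilizer Γ q.out) : ℕ∞) : ℝ≥0∞)⁻¹

/-- The normalisation of the (left) Haar measure on `G = Aut(X)`: for all uniform lattices `Γ`,
the covolume `μ(Γ\G)` (the measure of a fundamental domain for the left action of `Γ` on `G`)
equals the `V(X)`-covolume of `Γ`. -/
def IsNormalizedHaar (μ : Measure X.Aut) : Prop :=
  μ.IsHaarMeasure ∧
    ∀ Γ : Subgroup X.Aut, IsUniformLattice Γ → covolume Γ X.Aut μ = setCovolume Γ (X.Cell 0)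

end PolyhedralComplex

/-! Write G for Aut(X). The stabiliser G_s of a cell s is compact and open, so G is locally compact
and μ(G_s) is finite and positive for every Haar measure μ. Unfolding over a fundamental domain of a
uniform lattice Γ gives, for the set S of n-cells, Vol(Γ\\S) = μ(Γ\G) · Σ 1/μ(G_s), summed over
representatives s of the G-orbits in S (`tsum_inv_card_stabilizer_eq`). The sum, `orbitWeight μ n`,
does not involve Γ and scales inversely to μ. Scaling μ so that the vertex weight is 1 gives the
normalisation, and c(X) is then the inverse of the face weight.

The work lies in the hypotheses of this formula. Compactness of stabilisers
(`isCompact_setOf_smul_eq_self`) rests on the finiteness of the set of isometries between two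
polyhedra (`finite_setOf_isIsom`), on the finiteness of combinatorial balls, and on connectedness,
by which the balls exhaust X. Finiteness of balls uses that a closed cell is a finite union of open
cells (`exists_closedCell_eq_iUnion`), which needs every boundary point of a polyhedron to lie on a
facet (`exists_isFacet_mem`). Fundamental domains of finite measure come from
`exists_isFundamentalDomain_of_discrete` and `measure_fundamentalDomain_ne_top`. -/

namespace Polyhedral

variable {κ : Geometry}

/-! ### Radial projection onto the model space -/

/-- The open cone of vectors with a positive multiple in the model space. -/
def modelCone : Geometry → (n : ℕ) → Set (Fin (n + 1) → ℝ)
  | .spherical, _ => {x | 0 < ∑ i, x i ^ 2}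
  | .euclidean, _ => {x | 0 < x 0}
  | .hyperbolic, n => {x | 0 < x 0 ∧ 0 < x 0 ^ 2 - ∑ i : Fin n, x i.succ ^ 2}

/-- The positively homogeneous function which is equal to `1` on the model space. -/
noncomputable def modelScale : Geometry → {n : ℕ} → (Fin (n + 1) → ℝ) → ℝ
  | .spherical, _, x => √(∑ i, x i ^ 2)
  | .euclidean, _, x => x 0
  | .hyperbolic, n, x => √(x 0 ^ 2 - ∑ i : Fin n, x i.succ ^ 2)

theorem mem_modelSet_iff {n : ℕ} {x : Fin (n + 1) → ℝ} :
    x ∈ modelSet κ n ↔ x ∈ modelCone κ n ∧ modelScale κ x = 1 := by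
  cases κ
  · simp only [modelSet, modelCone, modelScale, Set.mem_ofPred_eq, Real.sqrt_eq_one]
    constructor
    · intro h; simp [h]
    · exact fun h => h.2
  · simp only [modelSet, modelCone, modelScale, Set.mem_ofPred_eq]
    constructor
    · intro h; simp [h]
    · exact fun h => h.2
  · simp only [modelSet, modelCone, modelScale, Set.mem_ofPred_eq, Real.sqrt_eq_one]
    constructor
    · rintro ⟨h, h'⟩; refine ⟨⟨h, ?_⟩, ?_⟩ <;> linarith
    · rintro ⟨⟨h, _⟩, h'⟩; exact ⟨h, by linarith⟩

theorem isOpen_modelCone (n : ℕ) : IsOpen (modelCone κ n) := by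
  cases κ
  · exact isOpen_lt (g := fun x : Fin (n + 1) → ℝ => ∑ i, x i ^ 2) continuous_const (by fun_prop)
  · exact isOpen_lt (g := fun x : Fin (n + 1) → ℝ => x 0) continuous_const (by fun_prop)
  · exact (isOpen_lt (g := fun x : Fin (n + 1) → ℝ => x 0) continuous_const (by fun_prop)).inter
      (isOpen_lt (g := fun x : Fin (n + 1) → ℝ => x 0 ^ 2 - ∑ i : Fin n, x i.succ ^ 2)
        continuous_const (by fun_prop))

theorem continuous_modelScale (n : ℕ) :
    Continuous (modelScale κ : (Fin (n + 1) → ℝ) → ℝ) := by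
  cases κ
  · exact (by fun_prop : Continuous fun x : Fin (n + 1) → ℝ => √(∑ i, x i ^ 2))
  · exact continuous_apply 0
  · exact (by fun_prop :
      Continuous fun x : Fin (n + 1) → ℝ => √(x 0 ^ 2 - ∑ i : Fin n, x i.succ ^ 2))

theorem modelScale_pos {n : ℕ} {x : Fin (n + 1) → ℝ} (hx : x ∈ modelCone κ n) :
    0 < modelScale κ x := by
  cases κ
  · exact Real.sqrt_pos.2 hx
  · exact hx
  · exact Real.sqrt_pos.2 hx.2

theorem modelScale_smul {n : ℕ} {t : ℝ} (ht : 0 ≤ t) (x : Fin (n + 1) → ℝ) :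
    modelScale κ (t • x) = t * modelScale κ x := by
  cases κ
  · simp only [modelScale, Pi.smul_apply, smul_eq_mul, mul_pow, ← Finset.mul_sum]
    rw [Real.sqrt_mul (sq_nonneg t), Real.sqrt_sq ht]
  · simp [modelScale]
  · simp only [modelScale, Pi.smul_apply, smul_eq_mul, mul_pow, ← Finset.mul_sum, ← mul_sub]
    rw [Real.sqrt_mul (sq_nonneg t), Real.sqrt_sq ht]

theorem smul_mem_modelCone {n : ℕ} {t : ℝ} (ht : 0 < t) {x : Fin (n + 1) → ℝ}
    (hx : x ∈ modelCone κ n) : t • x ∈ modelCone κ n := by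
  cases κ
  · simp only [modelCone, Set.mem_ofPred_eq, Pi.smul_apply, smul_eq_mul, mul_pow,
      ← Finset.mul_sum] at hx ⊢
    positivity
  · simp only [modelCone, Set.mem_ofPred_eq, Pi.smul_apply, smul_eq_mul] at hx ⊢
    positivity
  · simp only [modelCone, Set.mem_ofPred_eq, Pi.smul_apply, smul_eq_mul, mul_pow,
      ← Finset.mul_sum, ← mul_sub] at hx ⊢
    exact ⟨mul_pos ht hx.1, mul_pos (by positivity) hx.2⟩

/-- The radial projection of a vector of `modelCone` to the model space. -/
noncomputable def toModel {n : ℕ} (x : Fin (n + 1) → ℝ) (hx : x ∈ modelCone κ n) : Model κ n :=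
  ⟨(modelScale κ x)⁻¹ • x, mem_modelSet_iff.2
    ⟨smul_mem_modelCone (inv_pos.2 (modelScale_pos hx)) hx, by
      rw [modelScale_smul (inv_pos.2 (modelScale_pos hx)).le,
        inv_mul_cancel₀ (modelScale_pos hx).ne']⟩⟩

theorem smul_toModel {n : ℕ} (x : Fin (n + 1) → ℝ) (hx : x ∈ modelCone κ n) :
    modelScale κ x • (toModel x hx).1 = x :=
  smul_inv_smul₀ (modelScale_pos hx).ne' x

theorem Model.mem_modelCone {n : ℕ} (x : Model κ n) : x.1 ∈ modelCone κ n :=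
  (mem_modelSet_iff.1 x.2).1

theorem Model.modelScale_eq {n : ℕ} (x : Model κ n) : modelScale κ x.1 = 1 :=
  (mem_modelSet_iff.1 x.2).2

theorem Model.eq_of_eq_smul {n : ℕ} {x y : Model κ n} {t : ℝ} (ht : 0 ≤ t)
    (h : x.1 = t • y.1) : x = y := by
  have h1 := congrArg (modelScale κ) h
  rw [modelScale_smul ht, x.modelScale_eq, y.modelScale_eq, mul_one] at h1
  rw [← h1, one_smul] at h
  exact Subtype.ext h

theorem Model.ne_zero {n : ℕ} (x : Model κ n) : x.1 ≠ 0 := by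
  intro h
  have h1 := x.modelScale_eq
  rw [h, ← zero_smul ℝ (0 : Fin (n + 1) → ℝ), modelScale_smul le_rfl, zero_mul] at h1
  exact zero_ne_one h1

theorem sum_mul_lt_of_mem_modelCone {n : ℕ} {x y : Fin (n + 1) → ℝ}
    (hx : x ∈ modelCone .hyperbolic n) (hy : y ∈ modelCone .hyperbolic n) :
    ∑ i : Fin n, x i.succ * y i.succ < x 0 * y 0 := by
  obtain ⟨hx0, hx1⟩ := hx
  obtain ⟨hy0, hy1⟩ := hy
  have hcs := Finset.sum_mul_sq_le_sq_mul_sq Finset.univ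
    (fun i : Fin n => x i.succ) (fun i : Fin n => y i.succ)
  have h1 : (∑ i : Fin n, x i.succ ^ 2) * ∑ i : Fin n, y i.succ ^ 2 < x 0 ^ 2 * y 0 ^ 2 :=
    mul_lt_mul'' (by linarith) (by linarith) (Finset.sum_nonneg fun i _ => sq_nonneg _)
      (Finset.sum_nonneg fun i _ => sq_nonneg _)
  refine lt_of_pow_lt_pow_left₀ 2 (mul_pos hx0 hy0).le ?_
  rw [mul_pow]
  exact hcs.trans_lt h1

/-- In the hyperbolic case this is convexity of the open forward light cone. The sphere is excluded
because antipodal vectors cancel. -/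
theorem add_mem_modelCone {n : ℕ} (hκ : κ ≠ .spherical) {x y : Fin (n + 1) → ℝ}
    (hx : x ∈ modelCone κ n) (hy : y ∈ modelCone κ n) : x + y ∈ modelCone κ n := by
  cases κ
  · exact absurd rfl hκ
  · exact add_pos (show 0 < x 0 from hx) (show 0 < y 0 from hy)
  · refine ⟨add_pos hx.1 hy.1, ?_⟩
    have h := sum_mul_lt_of_mem_modelCone hx hy
    have : ∑ i : Fin n, (x + y) i.succ ^ 2 = ∑ i : Fin n, x i.succ ^ 2
        + ∑ i : Fin n, y i.succ ^ 2 + 2 * ∑ i : Fin n, x i.succ * y i.succ := by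
      rw [Finset.mul_sum, ← Finset.sum_add_distrib, ← Finset.sum_add_distrib]
      exact Finset.sum_congr rfl fun i _ => by simp only [Pi.add_apply]; ring
    rw [this, Pi.add_apply]
    nlinarith [hx.2, hy.2]

/-! ### Cones over polyhedra -/

/-- The convex cone spanned by finitely many points of the model space. -/
def coneHull {n : ℕ} (S : Finset (Model κ n)) : Set (Fin (n + 1) → ℝ) :=
  {x | ∃ w : Model κ n → ℝ, (∀ p ∈ S, 0 ≤ w p) ∧ x = ∑ p ∈ S, w p • p.1}

theorem mem_modelHull {n : ℕ} {S : Finset (Model κ n)} {x : Model κ n} :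
    x ∈ modelHull S ↔ x.1 ∈ coneHull S := Iff.rfl

theorem smul_mem_coneHull {n : ℕ} {S : Finset (Model κ n)} {t : ℝ} (ht : 0 ≤ t)
    {x : Fin (n + 1) → ℝ} (hx : x ∈ coneHull S) : t • x ∈ coneHull S := by
  obtain ⟨w, hw, rfl⟩ := hx
  exact ⟨fun p => t * w p, fun p hp => mul_nonneg ht (hw p hp), by
    simp [Finset.smul_sum, mul_smul]⟩

theorem add_mem_coneHull {n : ℕ} {S : Finset (Model κ n)}
    {x y : Fin (n + 1) → ℝ} (hx : x ∈ coneHull S) (hy : y ∈ coneHull S) : x + y ∈ coneHull S := by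
  obtain ⟨w, hw, rfl⟩ := hx
  obtain ⟨w', hw', rfl⟩ := hy
  exact ⟨fun p => w p + w' p, fun p hp => add_nonneg (hw p hp) (hw' p hp), by
    simp [Finset.sum_add_distrib, add_smul]⟩

theorem mem_coneHull_of_mem {n : ℕ} {S : Finset (Model κ n)} {p : Model κ n} (hp : p ∈ S) :
    p.1 ∈ coneHull S := by
  classical
  refine ⟨fun q => if q = p then 1 else 0, fun q _ => by positivity, ?_⟩
  simp [hp]

/-- On the sphere, positivity of ℓ keeps the sum away from 0. Otherwise the cone is closed under
addition, once the terms of weight 0 are dropped. -/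
theorem sum_smul_mem_modelCone {n : ℕ} {S : Finset (Model κ n)}
    (hS : ∃ ℓ : (Fin (n + 1) → ℝ) →ₗ[ℝ] ℝ, ∀ p ∈ S, 0 < ℓ p.1)
    {w : Model κ n → ℝ} (hw : ∀ p ∈ S, 0 ≤ w p) (h0 : ∃ p ∈ S, 0 < w p) :
    ∑ p ∈ S, w p • p.1 ∈ modelCone κ n := by
  classical
  by_cases hκ : κ = .spherical
  · subst hκ
    obtain ⟨ℓ, hℓ⟩ := hS
    have hpos : 0 < ℓ (∑ p ∈ S, w p • p.1) := by
      rw [map_sum]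
      simp only [map_smul, smul_eq_mul]
      obtain ⟨p, hp, hwp⟩ := h0
      exact Finset.sum_pos' (fun q hq => mul_nonneg (hw q hq) (hℓ q hq).le)
        ⟨p, hp, mul_pos hwp (hℓ p hp)⟩
    set x := ∑ p ∈ S, w p • p.1
    have hx : x ≠ 0 := by rintro h; rw [h, map_zero] at hpos; exact lt_irrefl _ hpos
    obtain ⟨i, hi⟩ := Function.ne_iff.1 hx
    have hi' : 0 < x i ^ 2 := sq_pos_of_ne_zero hi
    exact (Finset.sum_pos' (fun i _ => sq_nonneg _) ⟨i, Finset.mem_univ i, hi'⟩ :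
      0 < ∑ i, x i ^ 2)
  · clear hS
    rw [← Finset.sum_filter_of_ne (p := fun p => 0 < w p)]
    · obtain ⟨p, hp, hwp⟩ := h0
      refine Finset.sum_induction_nonempty _ (· ∈ modelCone κ n)
        (fun x y hx hy => add_mem_modelCone hκ hx hy) ⟨p, by simp [hp, hwp]⟩ ?_
      intro q hq
      exact smul_mem_modelCone (Finset.mem_filter.1 hq).2 q.mem_modelCone
    · intro q hq hne
      refine lt_of_le_of_ne (hw q hq) fun h => hne ?_
      rw [← h, zero_smul]

/-! ### Isometries preserve conical combinations -/

theorem sum_mul_sum_sum {ι : Type*} {n : ℕ} (s : Finset ι) (w w' : ι → ℝ) (a b : ι → Fin n → ℝ) :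
    ∑ i, (∑ j ∈ s, w j * a j i) * (∑ j ∈ s, w' j * b j i)
      = ∑ j ∈ s, ∑ k ∈ s, w j * w' k * ∑ i, a j i * b k i := by
  simp only [Finset.sum_mul_sum]
  rw [Finset.sum_comm]
  refine Finset.sum_congr rfl fun j _ => ?_
  rw [Finset.sum_comm]
  refine Finset.sum_congr rfl fun k _ => ?_
  rw [Finset.mul_sum]
  exact Finset.sum_congr rfl fun i _ => by ring

/-- The reversed Cauchy–Schwarz inequality. It places the Lorentz products where `Real.arcosh` is
injective, so that distances determine them. -/
theorem one_le_of_mem_hyperbolic {n : ℕ} (x y : Model .hyperbolic n) :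
    1 ≤ x.1 0 * y.1 0 - ∑ i : Fin n, x.1 i.succ * y.1 i.succ := by
  obtain ⟨hx0, hx⟩ := x.2
  obtain ⟨hy0, hy⟩ := y.2
  have hcs := Finset.sum_mul_sq_le_sq_mul_sq Finset.univ
    (fun i : Fin n => x.1 i.succ) (fun i : Fin n => y.1 i.succ)
  have hpos := sum_mul_lt_of_mem_modelCone x.mem_modelCone y.mem_modelCone
  have e1 : ∑ i : Fin n, x.1 i.succ ^ 2 = x.1 0 ^ 2 - 1 := by linarith
  have e2 : ∑ i : Fin n, y.1 i.succ ^ 2 = y.1 0 ^ 2 - 1 := by linarith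
  rw [e1, e2] at hcs
  set c := ∑ i : Fin n, x.1 i.succ * y.1 i.succ
  have h1 : 1 ≤ x.1 0 ^ 2 := by
    have : 0 ≤ ∑ i : Fin n, x.1 i.succ ^ 2 := Finset.sum_nonneg fun i _ => sq_nonneg _
    linarith
  have h2 : 1 ≤ y.1 0 ^ 2 := by
    have : 0 ≤ ∑ i : Fin n, y.1 i.succ ^ 2 := Finset.sum_nonneg fun i _ => sq_nonneg _
    linarith
  have h3 : 1 ≤ x.1 0 := by nlinarith
  have h4 : 1 ≤ y.1 0 := by nlinarith
  -- The difference of (x₀y₀ - 1)² and (x₀² - 1)(y₀² - 1) is (x₀ - y₀)².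
  have h5 : c ^ 2 ≤ (x.1 0 * y.1 0 - 1) ^ 2 := by nlinarith [sq_nonneg (x.1 0 - y.1 0)]
  have h6 := abs_le_of_sq_le_sq h5 (by nlinarith)
  linarith [(abs_le.1 h6).2]

/-- The squared norm of x - Σ wⱼpⱼ expands into inner products, which the distances determine; hence
it vanishes for the primed points too. -/
theorem spherical_eq_sum {ι : Type*} {m n : ℕ} {s : Finset ι} {w : ι → ℝ}
    {p : ι → Model .spherical m} {p' : ι → Model .spherical n}
    {x : Model .spherical m} {x' : Model .spherical n}
    (hpp : ∀ i ∈ s, ∀ j ∈ s, modelDist .spherical (p' i) (p' j) = modelDist .spherical (p i) (p j))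
    (hxp : ∀ i ∈ s, modelDist .spherical x' (p' i) = modelDist .spherical x (p i))
    (hx : x.1 = ∑ i ∈ s, w i • (p i).1) : x'.1 = ∑ i ∈ s, w i • (p' i).1 := by
  have hmem : ∀ {k : ℕ} (a b : Model .spherical k), ∑ i, a.1 i * b.1 i ∈ Set.Icc (-1 : ℝ) 1 := by
    intro k a b
    have ha : ∑ i, a.1 i ^ 2 = 1 := a.2
    have hb : ∑ i, b.1 i ^ 2 = 1 := b.2
    have hcs := Finset.sum_mul_sq_le_sq_mul_sq Finset.univ a.1 b.1
    rw [ha, hb] at hcs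
    exact abs_le.1 ((sq_le_one_iff_abs_le_one _).1 (by linarith))
  have inj : ∀ {a b : Model .spherical n} {c d : Model .spherical m},
      modelDist .spherical a b = modelDist .spherical c d →
        ∑ i, a.1 i * b.1 i = ∑ i, c.1 i * d.1 i :=
    fun h => Real.arccos_injOn (hmem _ _) (hmem _ _) h
  have expand : ∀ {k : ℕ} (a : Model .spherical k) (q : ι → Model .spherical k),
      ∑ i, (a.1 i - ∑ j ∈ s, w j * (q j).1 i) ^ 2
        = 1 - 2 * ∑ j ∈ s, w j * ∑ i, a.1 i * (q j).1 i
          + ∑ j ∈ s, ∑ k ∈ s, w j * w k * ∑ i, (q j).1 i * (q k).1 i := by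
    intro k a q
    have ha : ∑ i, a.1 i ^ 2 = 1 := a.2
    have hlin : 2 * ∑ j ∈ s, w j * ∑ i, a.1 i * (q j).1 i
        = ∑ i, 2 * a.1 i * ∑ j ∈ s, w j * (q j).1 i := by
      simp only [Finset.mul_sum]
      rw [Finset.sum_comm]
      exact Finset.sum_congr rfl fun i _ => Finset.sum_congr rfl fun j _ => by ring
    rw [← sum_mul_sum_sum, ← ha, hlin, ← Finset.sum_sub_distrib, ← Finset.sum_add_distrib]
    exact Finset.sum_congr rfl fun i _ => by ring
  have hzero : ∑ i, (x'.1 i - ∑ j ∈ s, w j * (p' j).1 i) ^ 2 = 0 := by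
    have h0 : ∑ i, (x.1 i - ∑ j ∈ s, w j * (p j).1 i) ^ 2 = 0 :=
      Finset.sum_eq_zero fun i _ => by rw [hx]; simp
    rw [expand] at h0 ⊢
    rw [← h0]
    congr 1
    · congr 2
      exact Finset.sum_congr rfl fun j hj => by rw [inj (hxp j hj)]
    · exact Finset.sum_congr rfl fun j hj => Finset.sum_congr rfl fun k hk => by
        rw [inj (hpp j hj k hk)]
  ext i
  have := (Finset.sum_eq_zero_iff_of_nonneg (fun i _ => sq_nonneg _)).1 hzero i (Finset.mem_univ i)
  simpa [sub_eq_zero] using this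

/-- The coordinate 0 forces the weights to sum to 1; then the squared norm of x - Σ wⱼpⱼ polarises
into squared distances. -/
theorem euclidean_eq_sum {ι : Type*} {m n : ℕ} {s : Finset ι} {w : ι → ℝ}
    {p : ι → Model .euclidean m} {p' : ι → Model .euclidean n}
    {x : Model .euclidean m} {x' : Model .euclidean n}
    (hpp : ∀ i ∈ s, ∀ j ∈ s, modelDist .euclidean (p' i) (p' j) = modelDist .euclidean (p i) (p j))
    (hxp : ∀ i ∈ s, modelDist .euclidean x' (p' i) = modelDist .euclidean x (p i))
    (hx : x.1 = ∑ i ∈ s, w i • (p i).1) : x'.1 = ∑ i ∈ s, w i • (p' i).1 := by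
  have zero_eq : ∀ {k : ℕ} (a : Model .euclidean k), a.1 0 = 1 := fun a => a.2
  have inj : ∀ {a b : Model .euclidean n} {c d : Model .euclidean m},
      modelDist .euclidean a b = modelDist .euclidean c d →
        ∑ i : Fin n, (a.1 i.succ - b.1 i.succ) ^ 2 = ∑ i : Fin m, (c.1 i.succ - d.1 i.succ) ^ 2 :=
    fun h => (Real.sqrt_inj (Finset.sum_nonneg fun i _ => sq_nonneg _)
      (Finset.sum_nonneg fun i _ => sq_nonneg _)).1 h
  have hw : ∑ j ∈ s, w j = 1 := by
    have := congrFun hx 0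
    simpa [zero_eq] using this.symm
  have expand : ∀ {k : ℕ} (a : Model .euclidean k) (q : ι → Model .euclidean k),
      ∑ i : Fin k, (a.1 i.succ - ∑ j ∈ s, w j * (q j).1 i.succ) ^ 2
        = ∑ j ∈ s, ∑ k' ∈ s, w j * w k' * ((∑ i : Fin k, (a.1 i.succ - (q j).1 i.succ) ^ 2
          + ∑ i : Fin k, (a.1 i.succ - (q k').1 i.succ) ^ 2
          - ∑ i : Fin k, ((q j).1 i.succ - (q k').1 i.succ) ^ 2) / 2) := by
    intro k a q
    have h1 : ∀ i : Fin k, a.1 i.succ - ∑ j ∈ s, w j * (q j).1 i.succ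
        = ∑ j ∈ s, w j * (a.1 i.succ - (q j).1 i.succ) := by
      intro i
      simp only [mul_sub, Finset.sum_sub_distrib, ← Finset.sum_mul, hw, one_mul]
    simp only [h1, sq (∑ j ∈ s, w j * _)]
    rw [sum_mul_sum_sum s w w (fun j (i : Fin k) => a.1 i.succ - (q j).1 i.succ)
      (fun j (i : Fin k) => a.1 i.succ - (q j).1 i.succ)]
    refine Finset.sum_congr rfl fun j _ => Finset.sum_congr rfl fun l _ => ?_
    rw [← Finset.sum_add_distrib, ← Finset.sum_sub_distrib, Finset.sum_div]
    congr 1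
    exact Finset.sum_congr rfl fun i _ => by ring
  have hzero : ∑ i : Fin n, (x'.1 i.succ - ∑ j ∈ s, w j * (p' j).1 i.succ) ^ 2 = 0 := by
    have h0 : ∑ i : Fin m, (x.1 i.succ - ∑ j ∈ s, w j * (p j).1 i.succ) ^ 2 = 0 :=
      Finset.sum_eq_zero fun i _ => by rw [hx]; simp
    rw [expand] at h0 ⊢
    rw [← h0]
    exact Finset.sum_congr rfl fun j hj => Finset.sum_congr rfl fun k hk => by
      rw [inj (hpp j hj k hk), inj (hxp j hj), inj (hxp k hk)]
  ext i
  refine Fin.cases ?_ (fun i => ?_) i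
  · simp [zero_eq, hw]
  · have := (Finset.sum_eq_zero_iff_of_nonneg (fun i _ => sq_nonneg _)).1 hzero i
      (Finset.mem_univ i)
    simpa [sub_eq_zero] using this

/-- The form B is indefinite, so B(d, d) = 0 for d = x' - z does not yet give d = 0. But d is also
B-orthogonal to the timelike vector x', and a null vector with this property vanishes. -/
theorem hyperbolic_eq_sum {ι : Type*} {m n : ℕ} {s : Finset ι} {w : ι → ℝ}
    {p : ι → Model .hyperbolic m} {p' : ι → Model .hyperbolic n}
    {x : Model .hyperbolic m} {x' : Model .hyperbolic n}
    (hpp : ∀ i ∈ s, ∀ j ∈ s,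
      modelDist .hyperbolic (p' i) (p' j) = modelDist .hyperbolic (p i) (p j))
    (hxp : ∀ i ∈ s, modelDist .hyperbolic x' (p' i) = modelDist .hyperbolic x (p i))
    (hx : x.1 = ∑ i ∈ s, w i • (p i).1) : x'.1 = ∑ i ∈ s, w i • (p' i).1 := by
  let B : ∀ {k : ℕ}, (Fin (k + 1) → ℝ) → (Fin (k + 1) → ℝ) → ℝ :=
    fun {k} a b => a 0 * b 0 - ∑ i : Fin k, a i.succ * b i.succ
  have inj : ∀ {a b : Model .hyperbolic n} {c d : Model .hyperbolic m},
      modelDist .hyperbolic a b = modelDist .hyperbolic c d → B a.1 b.1 = B c.1 d.1 :=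
    fun h => Real.arcosh_injOn (one_le_of_mem_hyperbolic _ _) (one_le_of_mem_hyperbolic _ _) h
  have self : ∀ {k : ℕ} (a : Model .hyperbolic k), B a.1 a.1 = 1 := by
    intro k a
    have := a.2.2
    simp only [B, ← sq]
    linarith
  have lin : ∀ {k : ℕ} (a : Model .hyperbolic k) (q : ι → Model .hyperbolic k),
      B a.1 (∑ j ∈ s, w j • (q j).1) = ∑ j ∈ s, w j * B a.1 (q j).1 := by
    intro k a q
    simp only [B, Finset.sum_apply, Pi.smul_apply, smul_eq_mul, Finset.mul_sum, mul_sub,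
      Finset.sum_sub_distrib]
    congr 1
    · exact Finset.sum_congr rfl fun j _ => by ring
    · rw [Finset.sum_comm]
      exact Finset.sum_congr rfl fun j _ => Finset.sum_congr rfl fun i _ => by ring
  have bilin : ∀ {k : ℕ} (q : ι → Model .hyperbolic k),
      B (∑ j ∈ s, w j • (q j).1) (∑ j ∈ s, w j • (q j).1)
        = ∑ j ∈ s, ∑ l ∈ s, w j * w l * B (q j).1 (q l).1 := by
    intro k q
    simp only [B, Finset.sum_apply, Pi.smul_apply, smul_eq_mul, mul_sub, Finset.sum_sub_distrib]
    congr 1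
    · rw [Finset.sum_mul_sum]
      exact Finset.sum_congr rfl fun j _ => Finset.sum_congr rfl fun l _ => by ring
    · exact sum_mul_sum_sum s w w (fun j (i : Fin k) => (q j).1 i.succ)
        (fun j (i : Fin k) => (q j).1 i.succ)
  have h1 : B x'.1 (∑ j ∈ s, w j • (p' j).1) = 1 := by
    rw [lin, ← self x]
    conv_rhs => rw [show B x.1 x.1 = B x.1 (∑ j ∈ s, w j • (p j).1) by rw [← hx], lin]
    exact Finset.sum_congr rfl fun j hj => by rw [inj (hxp j hj)]
  have h2 : B (∑ j ∈ s, w j • (p' j).1) (∑ j ∈ s, w j • (p' j).1) = 1 := by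
    rw [bilin, ← self x]
    conv_rhs => rw [hx, bilin]
    exact Finset.sum_congr rfl fun j hj => Finset.sum_congr rfl fun l hl => by
      rw [inj (hpp j hj l hl)]
  set z := ∑ j ∈ s, w j • (p' j).1
  have h3 := self x'
  simp only [B] at h1 h2 h3
  set d : Fin (n + 1) → ℝ := x'.1 - z with hd
  have e1 : ∑ i : Fin n, d i.succ ^ 2 = d 0 ^ 2 := by
    have : ∑ i : Fin n, d i.succ ^ 2 = ∑ i : Fin n, x'.1 i.succ * x'.1 i.succ
        - 2 * ∑ i : Fin n, x'.1 i.succ * z i.succ + ∑ i : Fin n, z i.succ * z i.succ := by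
      rw [Finset.mul_sum, ← Finset.sum_sub_distrib, ← Finset.sum_add_distrib]
      exact Finset.sum_congr rfl fun i _ => by simp only [hd, Pi.sub_apply]; ring
    rw [this]
    simp only [hd, Pi.sub_apply]
    nlinarith
  have e2 : ∑ i : Fin n, d i.succ * x'.1 i.succ = d 0 * x'.1 0 := by
    have : ∑ i : Fin n, d i.succ * x'.1 i.succ = ∑ i : Fin n, x'.1 i.succ * x'.1 i.succ
        - ∑ i : Fin n, x'.1 i.succ * z i.succ := by
      rw [← Finset.sum_sub_distrib]
      exact Finset.sum_congr rfl fun i _ => by simp only [hd, Pi.sub_apply]; ring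
    rw [this]
    simp only [hd, Pi.sub_apply]
    nlinarith
  have hcs := Finset.sum_mul_sq_le_sq_mul_sq Finset.univ
    (fun i : Fin n => d i.succ) (fun i : Fin n => x'.1 i.succ)
  have e3 : ∑ i : Fin n, x'.1 i.succ ^ 2 = x'.1 0 ^ 2 - 1 := by linarith [x'.2.2]
  rw [e1, e2, e3] at hcs
  -- Cauchy–Schwarz for the spatial parts now reads d₀² x₀² ≤ d₀² (x₀² - 1), with x₀ the first
  -- coordinate of x'.
  have d0 : d 0 = 0 := by
    have : d 0 ^ 2 ≤ 0 := by nlinarith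
    exact pow_eq_zero_iff two_ne_zero |>.1 (le_antisymm this (sq_nonneg _))
  rw [d0, zero_pow two_ne_zero] at e1
  have hd0 : d = 0 := by
    ext i
    refine Fin.cases d0 (fun i => ?_) i
    have := (Finset.sum_eq_zero_iff_of_nonneg (fun i _ => sq_nonneg _)).1 e1 i (Finset.mem_univ i)
    simpa using this
  exact sub_eq_zero.1 hd0

theorem eq_sum_of_modelDist_eq {ι : Type*} {m n : ℕ} {s : Finset ι} {w : ι → ℝ}
    {p : ι → Model κ m} {p' : ι → Model κ n} {x : Model κ m} {x' : Model κ n}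
    (hpp : ∀ i ∈ s, ∀ j ∈ s, modelDist κ (p' i) (p' j) = modelDist κ (p i) (p j))
    (hxp : ∀ i ∈ s, modelDist κ x' (p' i) = modelDist κ x (p i))
    (hx : x.1 = ∑ i ∈ s, w i • (p i).1) : x'.1 = ∑ i ∈ s, w i • (p' i).1 := by
  cases κ
  · exact spherical_eq_sum hpp hxp hx
  · exact euclidean_eq_sum hpp hxp hx
  · exact hyperbolic_eq_sum hpp hxp hx

end Polyhedral

/-! ### Combinatorics of a single polyhedron -/

namespace Polyhedral

variable {κ : Geometry}

/-! ### Extreme points and finiteness of the set of isometries -/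

/-- `x` is an extreme point of `P`: it spans an extreme ray of the cone over `P`. -/
def IsExtreme {n : ℕ} (P : Set (Model κ n)) (x : Model κ n) : Prop :=
  x ∈ P ∧ ∀ y ∈ P, ∀ z ∈ P, ∀ a b : ℝ, 0 < a → 0 < b → x.1 = a • y.1 + b • z.1 → y = x

/-- Split off from x one generator p of positive weight. The remaining sum, if not zero, projects
radially to a point of the hull, so extremality gives p = x. -/
theorem IsExtreme.mem_of_modelHull {n : ℕ} {S : Finset (Model κ n)}
    (hS : ∃ ℓ : (Fin (n + 1) → ℝ) →ₗ[ℝ] ℝ, ∀ p ∈ S, 0 < ℓ p.1) {x : Model κ n}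
    (hx : IsExtreme (modelHull S) x) : x ∈ S := by
  classical
  obtain ⟨⟨w, hw, hxw⟩, hext⟩ := hx
  obtain ⟨p, hp, hwp⟩ : ∃ p ∈ S, 0 < w p := by
    by_contra! h
    refine x.ne_zero ?_
    rw [hxw]
    exact Finset.sum_eq_zero fun p hp => by rw [le_antisymm (h p hp) (hw p hp), zero_smul]
  rw [← Finset.add_sum_erase S _ hp] at hxw
  suffices h : p = x by rwa [← h]
  by_cases h0 : ∃ q ∈ S.erase p, 0 < w q
  · have hw' : ∀ q ∈ S.erase p, 0 ≤ w q := fun q hq => hw q (Finset.mem_of_mem_erase hq)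
    obtain ⟨ℓ, hℓ⟩ := hS
    have hz := sum_smul_mem_modelCone ⟨ℓ, fun q hq => hℓ q (Finset.mem_of_mem_erase hq)⟩ hw' h0
    rw [← smul_toModel _ hz] at hxw
    refine hext p (mem_coneHull_of_mem hp) (toModel _ hz) ?_ _ _ hwp (modelScale_pos hz) hxw
    refine smul_mem_coneHull (inv_pos.2 (modelScale_pos hz)).le ?_
    refine ⟨fun q => if q = p then 0 else w q, fun q hq => ?_, ?_⟩
    · dsimp only; split_ifs
      exacts [le_rfl, hw q hq]
    · rw [← Finset.add_sum_erase S _ hp]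
      simp only [if_true, zero_smul, zero_add]
      exact Finset.sum_congr rfl fun q hq => by rw [if_neg (Finset.ne_of_mem_erase hq)]
  · push Not at h0
    rw [Finset.sum_eq_zero (fun q hq => by
      rw [le_antisymm (h0 q hq) (hw q (Finset.mem_of_mem_erase hq)), zero_smul]), add_zero] at hxw
    exact (Model.eq_of_eq_smul hwp.le hxw).symm

/-- Take a generating subset T of least size. If p in T is a combination of y and z, expand it over
T. A coefficient of p below 1 would let p be removed from T; otherwise positivity of ℓ kills all the
other coefficients, and y lies on the ray of p. -/
theorem exists_extreme_generators {n : ℕ} (S : Finset (Model κ n))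
    (hS : ∃ ℓ : (Fin (n + 1) → ℝ) →ₗ[ℝ] ℝ, ∀ p ∈ S, 0 < ℓ p.1) :
    ∃ T : Finset (Model κ n), modelHull T = modelHull S ∧ ∀ p ∈ T, IsExtreme (modelHull S) p := by
  classical
  have hex : ∃ T : Finset (Model κ n), T ⊆ S ∧ coneHull T = coneHull S := ⟨S, subset_rfl, rfl⟩
  obtain ⟨T, ⟨hTS, hT⟩, hmin⟩ : ∃ T : Finset (Model κ n), (T ⊆ S ∧ coneHull T = coneHull S) ∧
      ∀ T' : Finset (Model κ n), T' ⊆ S ∧ coneHull T' = coneHull S → T.card ≤ T'.card := by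
    obtain ⟨T, hT, hT'⟩ := WellFounded.has_min
      (measure (Finset.card : Finset (Model κ n) → ℕ)).wf
      {T : Finset (Model κ n) | T ⊆ S ∧ coneHull T = coneHull S} hex
    exact ⟨T, hT, fun T' h => not_lt.1 (hT' T' h)⟩
  have hhull : modelHull T = modelHull S := Set.ext fun x => by
    rw [mem_modelHull, mem_modelHull, hT]
  refine ⟨T, hhull, fun p hp => ⟨hhull ▸ mem_coneHull_of_mem hp, ?_⟩⟩
  rw [← hhull]
  rintro y ⟨wy, hwy, hy⟩ z ⟨wz, hwz, hz⟩ a b ha hb hab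
  obtain ⟨ℓ, hℓ⟩ := hS
  set c : Model κ n → ℝ := fun q => a * wy q + b * wz q with hc
  have hc0 : ∀ q ∈ T, 0 ≤ c q := fun q hq =>
    add_nonneg (mul_nonneg ha.le (hwy q hq)) (mul_nonneg hb.le (hwz q hq))
  have hpc : p.1 = ∑ q ∈ T, c q • q.1 := by
    rw [hab, hy, hz]
    simp [hc, Finset.smul_sum, add_smul, mul_smul, Finset.sum_add_distrib]
  rw [← Finset.add_sum_erase T _ hp] at hpc
  have hsub : (1 - c p) • p.1 = ∑ q ∈ T.erase p, c q • q.1 := by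
    rw [sub_smul, one_smul, sub_eq_iff_eq_add']
    exact hpc
  rcases lt_or_ge (c p) 1 with h | h
  · exfalso
    have hpos : 0 < 1 - c p := by linarith
    have hmem : p.1 ∈ coneHull (T.erase p) := by
      have : p.1 = (1 - c p)⁻¹ • ∑ q ∈ T.erase p, c q • q.1 := by
        rw [← hsub, inv_smul_smul₀ hpos.ne']
      rw [this]
      exact smul_mem_coneHull (inv_pos.2 hpos).le
        ⟨c, fun q hq => hc0 q (Finset.mem_of_mem_erase hq), rfl⟩
    have hcone : coneHull (T.erase p) = coneHull S := by
      rw [← hT]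
      apply Set.Subset.antisymm
      · rintro x ⟨w, hw, rfl⟩
        refine Finset.sum_induction _ (· ∈ coneHull T) (fun _ _ => add_mem_coneHull)
          ⟨0, fun _ _ => le_rfl, by simp⟩ fun q hq => ?_
        exact smul_mem_coneHull (hw q hq) (mem_coneHull_of_mem (Finset.mem_of_mem_erase hq))
      · rintro x ⟨w, hw, rfl⟩
        rw [← Finset.add_sum_erase T _ hp]
        exact add_mem_coneHull (smul_mem_coneHull (hw p hp) hmem)
          ⟨w, fun q hq => hw q (Finset.mem_of_mem_erase hq), rfl⟩
    have := hmin (T.erase p) ⟨(Finset.erase_subset _ _).trans hTS, hcone⟩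
    rw [Finset.card_erase_of_mem hp] at this
    have := Finset.card_pos.2 ⟨p, hp⟩
    omega
  · have hsum : ∑ q ∈ T.erase p, c q * ℓ q.1 ≤ 0 := by
      have := congrArg ℓ hsub
      rw [map_smul, map_sum] at this
      simp only [map_smul, smul_eq_mul] at this
      rw [← this]
      exact mul_nonpos_of_nonpos_of_nonneg (by linarith) (hℓ p (hTS hp)).le
    have hnn : ∀ q ∈ T.erase p, 0 ≤ c q * ℓ q.1 := fun q hq =>
      mul_nonneg (hc0 q (Finset.mem_of_mem_erase hq)) (hℓ q (hTS (Finset.mem_of_mem_erase hq))).le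
    have hz0 : ∀ q ∈ T.erase p, wy q = 0 := by
      intro q hq
      have h1 := (Finset.sum_eq_zero_iff_of_nonneg hnn).1
        (le_antisymm hsum (Finset.sum_nonneg hnn)) q hq
      have hq' := Finset.mem_of_mem_erase hq
      have h2 : c q = 0 := (mul_eq_zero.1 h1).resolve_right (hℓ q (hTS hq')).ne'
      have h3 : a * wy q = 0 := le_antisymm
        (by have := mul_nonneg hb.le (hwz q hq'); simp only [hc] at h2; linarith)
        (mul_nonneg ha.le (hwy q hq'))
      exact (mul_eq_zero.1 h3).resolve_left ha.ne'
    rw [← Finset.add_sum_erase T _ hp, Finset.sum_eq_zero (s := T.erase p) (fun q hq => by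
      rw [hz0 q hq, zero_smul]), add_zero] at hy
    exact Model.eq_of_eq_smul (hwy p hp) hy

theorem IsIsom.symm {m n : ℕ} {P : Set (Model κ m)} {Q : Set (Model κ n)} {e : P ≃ Q}
    (he : IsIsom e) : IsIsom e.symm := fun x y => by
  simpa using (he (e.symm x) (e.symm y)).symm

theorem IsIsom.eq_sum {m n : ℕ} {P : Set (Model κ m)} {Q : Set (Model κ n)} {e : P ≃ Q}
    (he : IsIsom e) {ι : Type*} {s : Finset ι} {w : ι → ℝ} {p : ι → P} {x : P}
    (hx : x.1.1 = ∑ i ∈ s, w i • (p i).1.1) : (e x).1.1 = ∑ i ∈ s, w i • (e (p i)).1.1 :=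
  eq_sum_of_modelDist_eq (p := fun i => (p i).1) (fun _ _ _ _ => he _ _) (fun _ _ => he _ _) hx

theorem IsIsom.isExtreme {m n : ℕ} {P : Set (Model κ m)} {Q : Set (Model κ n)} {e : P ≃ Q}
    (he : IsIsom e) {x : P} (hx : IsExtreme P x.1) : IsExtreme Q (e x).1 := by
  refine ⟨(e x).2, fun y hy z hz a b ha hb h => ?_⟩
  have h1 := he.symm.eq_sum (s := Finset.univ) (w := ![a, b])
    (p := ![(⟨y, hy⟩ : Q), (⟨z, hz⟩ : Q)]) (x := e x) (by simpa [Fin.sum_univ_two] using h)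
  simp only [Equiv.symm_apply_apply, Fin.sum_univ_two, Matrix.cons_val_zero,
    Matrix.cons_val_one] at h1
  have h2 := hx.2 _ (e.symm ⟨y, hy⟩).2 _ (e.symm ⟨z, hz⟩).2 a b ha hb h1
  have h3 : e.symm ⟨y, hy⟩ = x := Subtype.ext h2
  rw [← h3, Equiv.apply_symm_apply]

/-- There are only finitely many isometries between two compact convex polyhedra. -/
theorem finite_setOf_isIsom {m n : ℕ} {P : Set (Model κ m)} {Q : Set (Model κ n)}
    (hP : IsConvexPolyhedron P) (hQ : IsConvexPolyhedron Q) :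
    {e : P ≃ Q | IsIsom e}.Finite := by
  classical
  obtain ⟨S, hS, rfl, -⟩ := hP
  obtain ⟨S', hS', rfl, -⟩ := hQ
  obtain ⟨T, hT, hText⟩ := exists_extreme_generators S hS
  have hTP : ∀ t ∈ T, t ∈ modelHull S := fun t ht => (hText t ht).1
  -- Isometries send extreme points to extreme points, hence T into the finite set S'. Since they
  -- preserve conical combinations, the values on T determine them.
  let Φ : {e : modelHull S ≃ modelHull S' | IsIsom e} → T → S' := fun e t =>
    ⟨(e.1 ⟨t.1, hTP t.1 t.2⟩).1, (e.2.isExtreme (x := ⟨t.1, hTP t.1 t.2⟩)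
      (hText t.1 t.2)).mem_of_modelHull hS'⟩
  refine Set.finite_coe_iff.1 (Finite.of_injective Φ ?_)
  rintro ⟨e, he⟩ ⟨f, hf⟩ hef
  refine Subtype.ext (Equiv.ext fun x => Subtype.ext (Subtype.ext ?_))
  obtain ⟨w, -, hw⟩ := (Set.ext_iff.1 hT x.1).2 x.2
  rw [← Finset.sum_attach] at hw
  have h1 := IsIsom.eq_sum he (s := T.attach) (w := fun t => w t.1)
    (p := fun t => ⟨t.1, hTP t.1 t.2⟩) hw
  have h2 := IsIsom.eq_sum hf (s := T.attach) (w := fun t => w t.1)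
    (p := fun t => ⟨t.1, hTP t.1 t.2⟩) hw
  change (e x).1.1 = (f x).1.1
  rw [h1, h2]
  refine Finset.sum_congr rfl fun t _ => ?_
  have : (e ⟨t.1, hTP t.1 t.2⟩).1 = (f ⟨t.1, hTP t.1 t.2⟩).1 :=
    congrArg (fun s : S' => s.1) (congrFun hef t)
  rw [this]

/-! ### Facets -/

theorem convex_coneHull {n : ℕ} (S : Finset (Model κ n)) : Convex ℝ (coneHull S) :=
  fun _ hx _ hy _ _ ha hb _ => add_mem_coneHull (smul_mem_coneHull ha hx) (smul_mem_coneHull hb hy)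

/-- Radial projection is continuous on the open set `modelCone`, so the preimage of the interior of
the hull is an open subset of the cone. -/
theorem interior_coneHull_nonempty {n : ℕ} {S : Finset (Model κ n)}
    (h : (interior (modelHull S)).Nonempty) : (interior (coneHull S)).Nonempty := by
  obtain ⟨x, hx⟩ := h
  let f : modelCone κ n → Model κ n := fun v => toModel v.1 v.2
  have hf : Continuous f := by
    refine continuous_induced_rng.2 ?_
    have hs : Continuous fun v : modelCone κ n => (modelScale κ v.1)⁻¹ :=
      ((continuous_modelScale n).comp continuous_subtype_val).inv₀
        fun v => (modelScale_pos v.2).ne'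
    exact hs.smul continuous_subtype_val
  have hopen : IsOpen (Subtype.val '' (f ⁻¹' interior (modelHull S))) :=
    (isOpen_modelCone n).isOpenMap_subtype_val _ (isOpen_interior.preimage hf)
  refine ⟨x.1, interior_maximal ?_ hopen ⟨⟨x.1, x.mem_modelCone⟩, ?_, rfl⟩⟩
  · rintro _ ⟨v, hv, rfl⟩
    have h1 : f v ∈ modelHull S := interior_subset hv
    rw [← smul_toModel v.1 v.2]
    exact smul_mem_coneHull (modelScale_pos v.2).le h1
  · have : f ⟨x.1, x.mem_modelCone⟩ = x := Subtype.ext (by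
      change (modelScale κ x.1)⁻¹ • x.1 = x.1
      rw [x.modelScale_eq, inv_one, one_smul])
    rw [Set.mem_preimage, this]
    exact hx

theorem eq_zero_of_forall_mem {n : ℕ} {S : Finset (Model κ n)}
    (h : (interior (modelHull S)).Nonempty) {m : (Fin (n + 1) → ℝ) →ₗ[ℝ] ℝ}
    (hm : ∀ p ∈ S, m p.1 = 0) : m = 0 := by
  have h1 : ∀ x ∈ coneHull S, m x = 0 := by
    rintro x ⟨w, -, rfl⟩
    rw [map_sum]
    exact Finset.sum_eq_zero fun p hp => by rw [map_smul, hm p hp, smul_zero]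
  rw [← LinearMap.ker_eq_top]
  refine Submodule.eq_top_of_nonempty_interior' _ ((interior_coneHull_nonempty h).mono ?_)
  exact interior_mono fun x hx => h1 x hx

theorem nonneg_of_mem_coneHull {n : ℕ} {S : Finset (Model κ n)}
    {ℓ : (Fin (n + 1) → ℝ) →ₗ[ℝ] ℝ} (hℓ : ∀ p ∈ S, 0 ≤ ℓ p.1) {x : Fin (n + 1) → ℝ}
    (hx : x ∈ coneHull S) : 0 ≤ ℓ x := by
  obtain ⟨w, hw, rfl⟩ := hx
  rw [map_sum]
  exact Finset.sum_nonneg fun p hp => by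
    rw [map_smul]; exact mul_nonneg (hw p hp) (hℓ p hp)

/-- A vanishing sum of nonnegative terms has only zero terms: a face is the hull of the generators
on its hyperplane. Comparing faces thereby reduces to comparing finite sets. -/
theorem mem_face_iff {n : ℕ} {S : Finset (Model κ n)}
    {ℓ : (Fin (n + 1) → ℝ) →ₗ[ℝ] ℝ} (hℓ : ∀ p ∈ S, 0 ≤ ℓ p.1) {x : Model κ n} :
    (x ∈ modelHull S ∧ ℓ x.1 = 0) ↔
      ∃ w : Model κ n → ℝ, (∀ p ∈ S, 0 ≤ w p ∧ (w p ≠ 0 → ℓ p.1 = 0)) ∧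
        x.1 = ∑ p ∈ S, w p • p.1 := by
  constructor
  · rintro ⟨⟨w, hw, hx⟩, h0⟩
    refine ⟨w, fun p hp => ⟨hw p hp, fun hne => ?_⟩, hx⟩
    rw [hx, map_sum] at h0
    simp only [map_smul, smul_eq_mul] at h0
    exact (mul_eq_zero.1 ((Finset.sum_eq_zero_iff_of_nonneg
      fun q hq => mul_nonneg (hw q hq) (hℓ q hq)).1 h0 p hp)).resolve_left hne
  · rintro ⟨w, hw, hx⟩
    refine ⟨⟨w, fun p hp => (hw p hp).1, hx⟩, ?_⟩
    rw [hx, map_sum]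
    refine Finset.sum_eq_zero fun p hp => ?_
    rw [map_smul, smul_eq_mul]
    by_cases h : w p = 0
    · rw [h, zero_mul]
    · rw [(hw p hp).2 h, mul_zero]

/-- Rotating a supporting hyperplane about the face that it cuts out, until it meets another
generator. -/
theorem exists_tilt {n : ℕ} {S : Finset (Model κ n)} (h : (interior (modelHull S)).Nonempty)
    {ℓ m : (Fin (n + 1) → ℝ) →ₗ[ℝ] ℝ} (hℓ : ∀ p ∈ S, 0 ≤ ℓ p.1)
    (hm : ∀ p ∈ S, ℓ p.1 = 0 → m p.1 = 0) (hind : LinearIndependent ℝ ![ℓ, m]) :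
    ∃ ℓ' : (Fin (n + 1) → ℝ) →ₗ[ℝ] ℝ, ℓ' ≠ 0 ∧ (∀ p ∈ S, 0 ≤ ℓ' p.1) ∧
      (∀ p ∈ S, ℓ p.1 = 0 → ℓ' p.1 = 0) ∧ ∃ p ∈ S, 0 < ℓ p.1 ∧ ℓ' p.1 = 0 := by
  classical
  -- If m is nowhere negative on S, use -m; were both nowhere negative, m would vanish on S and so
  -- be 0.
  wlog hneg : ∃ p ∈ S, m p.1 < 0 generalizing m
  · push Not at hneg
    refine this (m := -m) (fun p hp h0 => by simp [hm p hp h0]) ?_ ?_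
    · rw [LinearIndependent.pair_iff] at hind ⊢
      intro s t hst
      obtain ⟨h1, h2⟩ := hind s (-t) (by rw [← hst]; simp)
      exact ⟨h1, neg_eq_zero.1 h2⟩
    · by_contra! hcon
      have hm0 : m = 0 := eq_zero_of_forall_mem h fun p hp =>
        le_antisymm (by simpa using hcon p hp) (hneg p hp)
      exact hind.ne_zero 1 (by simp [hm0])
  have hpos : ∀ p ∈ S, m p.1 < 0 → 0 < ℓ p.1 := fun p hp hlt =>
    lt_of_le_of_ne (hℓ p hp) fun h0 => hlt.ne (hm p hp h0.symm)
  obtain ⟨p, hp, hmin⟩ := Finset.exists_min_image (S.filter fun p => m p.1 < 0)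
    (fun p => ℓ p.1 / -m p.1) (by obtain ⟨p, hp, hlt⟩ := hneg; exact ⟨p, by simp [hp, hlt]⟩)
  rw [Finset.mem_filter] at hp
  -- The largest t for which ℓ + t • m stays nonnegative on S; at the minimiser p it vanishes.
  set t := ℓ p.1 / -m p.1 with ht
  have htpos : 0 < t := div_pos (hpos p hp.1 hp.2) (by linarith [hp.2])
  refine ⟨ℓ + t • m, fun h0 => ?_, fun q hq => ?_, fun q hq h0 => ?_,
    p, hp.1, hpos p hp.1 hp.2, ?_⟩
  · have := (LinearIndependent.pair_iff.1 hind 1 t (by rw [one_smul]; exact h0)).1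
    exact one_ne_zero this
  · simp only [LinearMap.add_apply, LinearMap.smul_apply, smul_eq_mul]
    rcases lt_or_ge (m q.1) 0 with hlt | hge
    · have h1 := hmin q (Finset.mem_filter.2 ⟨hq, hlt⟩)
      rw [le_div_iff₀ (by linarith)] at h1
      linarith
    · have := hℓ q hq
      positivity
  · simp [h0, hm q hq h0]
  · simp only [LinearMap.add_apply, LinearMap.smul_apply, smul_eq_mul, ht]
    have := hp.2.ne
    field_simp
    ring

/-- Every supporting hyperplane of a polyhedron can be replaced by one that cuts out a facet
containing the given face. -/
theorem exists_facet_functional {n : ℕ} {S : Finset (Model κ n)}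
    (h : (interior (modelHull S)).Nonempty) {ℓ : (Fin (n + 1) → ℝ) →ₗ[ℝ] ℝ}
    (hℓ0 : ℓ ≠ 0) (hℓ : ∀ p ∈ S, 0 ≤ ℓ p.1) :
    ∃ ℓ' : (Fin (n + 1) → ℝ) →ₗ[ℝ] ℝ, (∀ p ∈ S, 0 ≤ ℓ' p.1) ∧
      (∀ p ∈ S, ℓ p.1 = 0 → ℓ' p.1 = 0) ∧
      Module.finrank ℝ (Submodule.span ℝ (Subtype.val '' {p | p ∈ S ∧ ℓ' p.1 = 0})) = n := by
  classical
  let d : ((Fin (n + 1) → ℝ) →ₗ[ℝ] ℝ) → ℕ := fun ℓ' =>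
    Module.finrank ℝ (Submodule.span ℝ (Subtype.val '' {p | p ∈ S ∧ ℓ' p.1 = 0}))
  let A : Set ((Fin (n + 1) → ℝ) →ₗ[ℝ] ℝ) := {ℓ' | ℓ' ≠ 0 ∧ (∀ p ∈ S, 0 ≤ ℓ' p.1) ∧
    ∀ p ∈ S, ℓ p.1 = 0 → ℓ' p.1 = 0}
  have hspan : ∀ ℓ' : (Fin (n + 1) → ℝ) →ₗ[ℝ] ℝ,
      Submodule.span ℝ (Subtype.val '' {p | p ∈ S ∧ ℓ' p.1 = 0}) ≤ LinearMap.ker ℓ' := by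
    intro ℓ'
    rw [Submodule.span_le]
    rintro _ ⟨p, hp, rfl⟩
    exact hp.2
  have hker : ∀ ℓ' : (Fin (n + 1) → ℝ) →ₗ[ℝ] ℝ, ℓ' ≠ 0 →
      Module.finrank ℝ (LinearMap.ker ℓ') = n := by
    intro ℓ' h0
    have h1 := Module.Dual.finrank_ker_add_one_of_ne_zero (f := ℓ') h0
    rw [Module.finrank_fin_fun] at h1
    omega
  have hdle : ∀ ℓ' ∈ A, d ℓ' ≤ n := fun ℓ' hA =>
    (Submodule.finrank_mono (hspan ℓ')).trans_eq (hker ℓ' hA.1)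
  -- Choose a supporting functional whose face spans the largest dimension. If that were less than
  -- n, some m would vanish on the span V but not on the whole kernel of ℓ', and tilting along m
  -- would enlarge V.
  obtain ⟨ℓ', hA, hmax⟩ : ∃ ℓ' ∈ A, ∀ ℓ'' ∈ A, d ℓ'' ≤ d ℓ' := by
    have hne : (d '' A).Nonempty := ⟨_, ℓ, ⟨hℓ0, hℓ, fun _ _ h => h⟩, rfl⟩
    have hbdd : BddAbove (d '' A) := ⟨n, by rintro _ ⟨ℓ', h', rfl⟩; exact hdle ℓ' h'⟩
    obtain ⟨ℓ', hA, heq⟩ := Nat.sSup_mem hne hbdd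
    exact ⟨ℓ', hA, fun ℓ'' h'' => heq ▸ le_csSup hbdd ⟨ℓ'', h'', rfl⟩⟩
  refine ⟨ℓ', hA.2.1, hA.2.2, ?_⟩
  by_contra hne
  have hlt : d ℓ' < n := lt_of_le_of_ne (hdle ℓ' hA) hne
  set V := Submodule.span ℝ (Subtype.val '' {p : Model κ n | p ∈ S ∧ ℓ' p.1 = 0}) with hV
  obtain ⟨x, hxk, hxV⟩ : ∃ x ∈ LinearMap.ker ℓ', x ∉ V := by
    by_contra! hcon
    have : LinearMap.ker ℓ' = V := le_antisymm hcon (hspan ℓ')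
    have h2 := hker ℓ' hA.1
    rw [this] at h2
    exact hne h2
  obtain ⟨m, hmx, hmV⟩ := Submodule.exists_dual_map_eq_bot_of_notMem hxV inferInstance
  have hmV' : ∀ y ∈ V, m y = 0 := fun y hy => by
    have : m y ∈ V.map m := Submodule.mem_map_of_mem hy
    rwa [hmV, Submodule.mem_bot] at this
  have hind : LinearIndependent ℝ ![ℓ', m] := by
    rw [LinearIndependent.pair_iff]
    intro s t hst
    have ht : t = 0 := by
      have := LinearMap.congr_fun hst x
      rw [LinearMap.add_apply, LinearMap.smul_apply, LinearMap.smul_apply,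
        LinearMap.mem_ker.1 hxk, smul_zero, zero_add] at this
      exact (smul_eq_zero.1 this).resolve_right hmx
    rw [ht, zero_smul, add_zero] at hst
    exact ⟨(smul_eq_zero.1 hst).resolve_right hA.1, ht⟩
  obtain ⟨ℓ'', h0, hnn, hvan, p, hp, hpos, hp0⟩ := exists_tilt h hA.2.1
    (fun p hp h0 => hmV' _ (Submodule.subset_span ⟨p, ⟨hp, h0⟩, rfl⟩)) hind
  have hA'' : ℓ'' ∈ A := ⟨h0, hnn, fun q hq hq0 => hvan q hq (hA.2.2 q hq hq0)⟩
  have hVlt : V < Submodule.span ℝ (Subtype.val '' {p : Model κ n | p ∈ S ∧ ℓ'' p.1 = 0}) := by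
    refine lt_of_le_of_ne (Submodule.span_mono (Set.image_mono fun q hq =>
      ⟨hq.1, hvan q hq.1 hq.2⟩)) fun heq => ?_
    have : p.1 ∈ V := heq ▸ Submodule.subset_span ⟨p, ⟨hp, hp0⟩, rfl⟩
    exact hpos.ne' (hspan ℓ' this)
  exact absurd (hmax ℓ'' hA'') (not_le.2 (Submodule.finrank_lt_finrank_of_lt hVlt))

theorem isFacet_of_functional {n : ℕ} {S : Finset (Model κ (n + 1))}
    {ℓ : (Fin (n + 1 + 1) → ℝ) →ₗ[ℝ] ℝ} (hℓ : ∀ p ∈ S, 0 ≤ ℓ p.1)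
    (hrank : Module.finrank ℝ
      (Submodule.span ℝ (Subtype.val '' {p | p ∈ S ∧ ℓ p.1 = 0})) = n + 1) :
    IsFacet (modelHull S) {x | x ∈ modelHull S ∧ ℓ x.1 = 0} := by
  refine ⟨ℓ, fun x hx => nonneg_of_mem_coneHull hℓ hx, rfl, ?_⟩
  refine Eq.trans (congrArg (fun V : Submodule ℝ _ => Module.finrank ℝ V) ?_) hrank
  apply le_antisymm
  · rw [Submodule.span_le]
    rintro _ ⟨x, hx, rfl⟩
    obtain ⟨w, hw, hx⟩ := (mem_face_iff hℓ).1 hx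
    rw [hx]
    refine Submodule.sum_mem _ fun p hp => ?_
    by_cases h : w p = 0
    · rw [h, zero_smul]; exact Submodule.zero_mem _
    · exact Submodule.smul_mem _ _ (Submodule.subset_span ⟨p, ⟨hp, (hw p hp).2 h⟩, rfl⟩)
  · exact Submodule.span_mono (Set.image_mono fun p hp => ⟨mem_coneHull_of_mem hp.1, hp.2⟩)

/-- By `mem_face_iff`, a facet is determined by the subset of generators that it contains. -/
theorem finite_setOf_isFacet {n : ℕ} {P : Set (Model κ (n + 1))} (hP : IsConvexPolyhedron P) :
    {F | IsFacet P F}.Finite := by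
  classical
  obtain ⟨S, -, rfl, -⟩ := hP
  refine Set.Finite.of_finite_image (f := fun F => {p | p ∈ S ∧ p ∈ F}) ?_ ?_
  · refine (S.finite_toSet.finite_subsets).subset ?_
    rintro _ ⟨F, -, rfl⟩ p hp
    exact hp.1
  · rintro F ⟨ℓ, hℓ, hF, -⟩ F' ⟨ℓ', hℓ', hF', -⟩ heq
    have hS : ∀ p ∈ S, 0 ≤ ℓ p.1 := fun p hp => hℓ p (mem_coneHull_of_mem hp)
    have hS' : ∀ p ∈ S, 0 ≤ ℓ' p.1 := fun p hp => hℓ' p (mem_coneHull_of_mem hp)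
    have hiff : ∀ p ∈ S, ℓ p.1 = 0 ↔ ℓ' p.1 = 0 := by
      intro p hp
      have h1 := Set.ext_iff.1 heq p
      rw [hF, hF'] at h1
      have hp' : p ∈ modelHull S := mem_coneHull_of_mem hp
      exact ⟨fun h => (h1.1 ⟨hp, hp', h⟩).2.2, fun h => (h1.2 ⟨hp, hp', h⟩).2.2⟩
    rw [hF, hF']
    ext x
    rw [Set.mem_ofPred_eq, Set.mem_ofPred_eq, mem_face_iff hS, mem_face_iff hS']
    refine exists_congr fun w => and_congr_left fun _ => forall₂_congr fun p hp => ?_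
    rw [hiff p hp]

/-- Hahn–Banach is applied to the cone over the polyhedron: a point outside the interior of the
polyhedron is outside the interior of the cone. -/
theorem exists_supporting_functional {n : ℕ} {S : Finset (Model κ n)}
    (h : (interior (modelHull S)).Nonempty) {x : Model κ n} (hx : x ∈ modelHull S)
    (hxi : x ∉ interior (modelHull S)) :
    ∃ ℓ : (Fin (n + 1) → ℝ) →ₗ[ℝ] ℝ, ℓ ≠ 0 ∧ (∀ p ∈ S, 0 ≤ ℓ p.1) ∧ ℓ x.1 = 0 := by
  have hxc : x.1 ∉ interior (coneHull S) := fun hc => hxi <|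
    interior_maximal (s := modelHull S) (fun y hy => interior_subset (s := coneHull S) hy)
      (isOpen_interior.preimage continuous_subtype_val) hc
  obtain ⟨f, hf⟩ := geometric_hahn_banach_open_point (convex_coneHull S).interior
    isOpen_interior hxc
  have hne := interior_coneHull_nonempty h
  have hle : ∀ y ∈ coneHull S, f y ≤ f x.1 := by
    intro y hy
    have hcl : y ∈ closure (interior (coneHull S)) := by
      rw [(convex_coneHull S).closure_interior_eq_closure_of_nonempty_interior hne]
      exact subset_closure hy
    exact closure_minimal (t := {y | f y ≤ f x.1}) (fun z hz => (hf z hz).le)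
      (isClosed_le f.continuous continuous_const) hcl
  -- The cone contains 0 and 2x, so the maximum of f on the cone, taken at x, must be 0.
  have h0 : f x.1 = 0 := by
    have h2 := hle _ (smul_mem_coneHull (zero_le_two) hx)
    have h1 := hle _ (smul_mem_coneHull le_rfl hx)
    rw [map_smul, smul_eq_mul] at h2
    rw [zero_smul, map_zero] at h1
    linarith
  refine ⟨-f.toLinearMap, fun hz => ?_, fun p hp => ?_, by simp [h0]⟩
  · obtain ⟨y, hy⟩ := hne
    have h1 := hf y hy
    have h2 := LinearMap.congr_fun hz y
    simp only [LinearMap.neg_apply, ContinuousLinearMap.coe_coe, LinearMap.zero_apply,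
      neg_eq_zero] at h2
    linarith
  · have := hle p.1 (mem_coneHull_of_mem hp)
    simp only [LinearMap.neg_apply, ContinuousLinearMap.coe_coe]
    linarith

/-- A point of a polyhedron which is not an interior point lies on a facet. -/
theorem exists_isFacet_mem {n : ℕ} {P : Set (Model κ (n + 1))} (hP : IsConvexPolyhedron P)
    {x : Model κ (n + 1)} (hx : x ∈ P) (hxi : x ∉ interior P) : ∃ F, IsFacet P F ∧ x ∈ F := by
  obtain ⟨S, -, rfl, h⟩ := hP
  obtain ⟨ℓ, h0, hℓ, hℓx⟩ := exists_supporting_functional h hx hxi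
  obtain ⟨ℓ', hℓ', hvan, hrank⟩ := exists_facet_functional h h0 hℓ
  refine ⟨_, isFacet_of_functional hℓ' hrank, ?_⟩
  obtain ⟨w, hw, hxw⟩ := (mem_face_iff hℓ).1 ⟨hx, hℓx⟩
  exact (mem_face_iff hℓ').2
    ⟨w, fun p hp => ⟨(hw p hp).1, fun hne => hvan p hp ((hw p hp).2 hne)⟩, hxw⟩

/-- The functional that is positive on all generators supports the empty face and can be tilted to a
facet. This yields vertices in a polygonal complex. -/
theorem exists_isFacet {n : ℕ} {P : Set (Model κ (n + 1))} (hP : IsConvexPolyhedron P) :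
    ∃ F, IsFacet P F := by
  obtain ⟨S, ⟨ℓ, hℓ⟩, rfl, h⟩ := hP
  have h0 : ℓ ≠ 0 := by
    rintro rfl
    obtain ⟨x, hx⟩ := h
    obtain ⟨w, -, hw⟩ := interior_subset hx
    refine x.ne_zero ?_
    rw [hw]
    exact Finset.sum_eq_zero fun p hp => absurd (hℓ p hp) (by simp)
  obtain ⟨ℓ', hℓ', -, hrank⟩ := exists_facet_functional h h0 fun p hp => (hℓ p hp).le
  exact ⟨_, isFacet_of_functional hℓ' hrank⟩

theorem subset_interior_of_dim_zero {P : Set (Model κ 0)} (hP : IsConvexPolyhedron P) :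
    P ⊆ interior P := by
  intro x hx
  by_contra hxi
  obtain ⟨S, -, rfl, h⟩ := hP
  obtain ⟨ℓ, h0, -, hℓx⟩ := exists_supporting_functional h hx hxi
  have hx0 : x.1 0 ≠ 0 := fun h => x.ne_zero (funext fun i => by rw [Fin.fin_one_eq_zero i]; exact h)
  refine h0 (LinearMap.ext fun y => ?_)
  have : y = (y 0 / x.1 0) • x.1 := funext fun i => by
    rw [Fin.fin_one_eq_zero i, Pi.smul_apply, smul_eq_mul, div_mul_cancel₀ _ hx0]
  rw [this, map_smul, hℓx, smul_zero, LinearMap.zero_apply]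

end Polyhedral

/-! ### From the cell structure of X to the topological group Aut(X) -/

namespace PolyhedralComplex

variable {κ : Geometry} (X : PolyhedralComplex.{u, v} κ)

/-! ### Open and closed cells -/

/-- The open cell of `X` given by `σ`, as a set of points. -/
def openCell {n : ℕ} (σ : X.Cell n) : Set X.Point :=
  {p | ∃ x : X.shape σ, x.1 ∈ interior (X.shape σ) ∧ X.charMap σ x = p}

theorem openCell_nonempty {n : ℕ} (σ : X.Cell n) : (X.openCell σ).Nonempty := by
  obtain ⟨S, -, -, x, hx⟩ := X.shape_isConvexPolyhedron σ
  exact ⟨_, ⟨x, interior_subset hx⟩, hx, rfl⟩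

theorem openCell_subset_closedCell {n : ℕ} (σ : X.Cell n) : X.openCell σ ⊆ X.closedCell σ := by
  rintro _ ⟨x, -, rfl⟩
  exact ⟨x, rfl⟩

theorem exists_mem_openCell (p : X.Point) : ∃ τ : (n : ℕ) × X.Cell n, p ∈ X.openCell τ.2 := by
  obtain ⟨⟨τ, x, hx⟩, rfl⟩ := X.bijective_charMap.2 p
  exact ⟨τ, x, hx, rfl⟩

theorem exists_mem_closedCell (p : X.Point) : ∃ τ : (n : ℕ) × X.Cell n, p ∈ X.closedCell τ.2 :=
  (X.exists_mem_openCell p).imp fun τ h => X.openCell_subset_closedCell τ.2 h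

variable {X}

theorem eq_of_mem_openCell {p : X.Point} {τ τ' : (n : ℕ) × X.Cell n} (h : p ∈ X.openCell τ.2)
    (h' : p ∈ X.openCell τ'.2) : τ = τ' := by
  obtain ⟨x, hx, hxp⟩ := h
  obtain ⟨x', hx', hxp'⟩ := h'
  have := X.bijective_charMap.1 (a₁ := ⟨τ, x, hx⟩) (a₂ := ⟨τ', x', hx'⟩) (hxp.trans hxp'.symm)
  exact congrArg Sigma.fst this

/-- A closed cell is the union of its open cell and of finitely many open cells of smaller
dimension. -/
theorem exists_closedCell_eq_iUnion {n : ℕ} (σ : X.Cell n) :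
    ∃ A : Set ((m : ℕ) × X.Cell m), A.Finite ∧ (∀ τ ∈ A, τ = ⟨n, σ⟩ ∨ τ.1 < n) ∧
      X.closedCell σ = ⋃ τ ∈ A, X.openCell τ.2 := by
  induction n with
  | zero =>
    refine ⟨{⟨0, σ⟩}, Set.finite_singleton _, fun τ hτ => Or.inl hτ, ?_⟩
    rw [Set.biUnion_singleton]
    refine Set.Subset.antisymm ?_ (X.openCell_subset_closedCell σ)
    rintro _ ⟨x, rfl⟩
    exact ⟨x, subset_interior_of_dim_zero (X.shape_isConvexPolyhedron σ) x.2, rfl⟩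
  | succ n ih =>
    choose B hBfin hBdim hB using ih
    have hfacet : ∀ F : {F | IsFacet (X.shape σ) F}, ∃ τ : X.Cell n,
        X.closedCell τ ⊆ X.closedCell σ ∧ ∀ x, x.1 ∈ F.1 → X.charMap σ x ∈ X.closedCell τ := by
      rintro ⟨F, hF⟩
      obtain ⟨τ, e, -, hcompat⟩ := X.exists_facet_isom σ F hF
      refine ⟨τ, ?_, fun x hx => ⟨e ⟨x.1, hx⟩, (hcompat ⟨x.1, hx⟩ x.2).symm⟩⟩
      rintro _ ⟨y, rfl⟩
      have hsub : (e.symm y).1 ∈ X.shape σ := by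
        obtain ⟨ℓ, -, hFeq, -⟩ := hF
        exact ((Set.ext_iff.1 hFeq _).1 (e.symm y).2).1
      exact ⟨⟨_, hsub⟩, by rw [hcompat (e.symm y) hsub, Equiv.apply_symm_apply]⟩
    choose τ hτ hmemτ using hfacet
    have : Finite {F | IsFacet (X.shape σ) F} :=
      finite_setOf_isFacet (X.shape_isConvexPolyhedron σ)
    refine ⟨{⟨n + 1, σ⟩} ∪ ⋃ F, B (τ F),
      (Set.finite_singleton _).union (Set.finite_iUnion fun F => hBfin _), ?_, ?_⟩
    · rintro ρ (hρ | hρ)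
      · exact Or.inl hρ
      · obtain ⟨F, hρ⟩ := Set.mem_iUnion.1 hρ
        rcases hBdim _ ρ hρ with rfl | h
        · exact Or.inr (Nat.lt_succ_self n)
        · exact Or.inr (h.trans (Nat.lt_succ_self n))
    · rw [Set.biUnion_union, Set.biUnion_singleton]
      apply Set.Subset.antisymm
      · rintro _ ⟨x, rfl⟩
        by_cases hx : x.1 ∈ interior (X.shape σ)
        · exact Or.inl ⟨x, hx, rfl⟩
        · right
          obtain ⟨F, hF, hxF⟩ := exists_isFacet_mem (X.shape_isConvexPolyhedron σ) x.2 hx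
          have h1 := hmemτ ⟨F, hF⟩ x hxF
          rw [hB] at h1
          obtain ⟨ρ, hρ, hmem⟩ := Set.mem_iUnion₂.1 h1
          exact Set.mem_iUnion₂.2 ⟨ρ, Set.mem_iUnion.2 ⟨_, hρ⟩, hmem⟩
      · refine Set.union_subset (X.openCell_subset_closedCell σ) ?_
        intro p hp
        obtain ⟨ρ, hρ, hmem⟩ := Set.mem_iUnion₂.1 hp
        obtain ⟨F, hρF⟩ := Set.mem_iUnion.1 hρ
        refine hτ F ?_
        rw [hB]
        exact Set.mem_iUnion₂.2 ⟨ρ, hρF, hmem⟩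

theorem openCell_subset_closedCell_of_mem {ρ : (n : ℕ) × X.Cell n} {n : ℕ} {τ : X.Cell n}
    {p : X.Point} (hρ : p ∈ X.openCell ρ.2) (hτ : p ∈ X.closedCell τ) :
    X.openCell ρ.2 ⊆ X.closedCell τ := by
  obtain ⟨A, -, -, hA⟩ := exists_closedCell_eq_iUnion τ
  rw [hA] at hτ ⊢
  obtain ⟨ρ', hρ', hp⟩ := Set.mem_iUnion₂.1 hτ
  rw [eq_of_mem_openCell hρ hp]
  exact Set.subset_biUnion_of_mem (u := fun τ : (n : ℕ) × X.Cell n => X.openCell τ.2) hρ'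

/-- The open cell of σ occurs among the open cells that make up the closed cell of τ, and all of
these except τ itself have smaller dimension. Hence the action on points determines the action on
cells. -/
theorem closedCell_injective {n : ℕ} {σ τ : X.Cell n}
    (h : X.closedCell σ = X.closedCell τ) : σ = τ := by
  obtain ⟨p, hp⟩ := X.openCell_nonempty σ
  obtain ⟨A, -, hdim, hA⟩ := exists_closedCell_eq_iUnion τ
  have h1 : p ∈ X.closedCell τ := h ▸ X.openCell_subset_closedCell σ hp
  rw [hA] at h1
  obtain ⟨ρ, hρ, hpρ⟩ := Set.mem_iUnion₂.1 h1
  have h2 : (⟨n, σ⟩ : (n : ℕ) × X.Cell n) = ρ := eq_of_mem_openCell hp hpρ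
  subst h2
  rcases hdim _ hρ with h3 | h3
  · simpa using h3
  · exact absurd h3 (lt_irrefl _)

/-- Local finiteness concerns single points, but a closed cell that meets an open cell contains it.
So one sample point in each of the finitely many open cells of σ suffices. -/
theorem IsLocallyFinite.finite_setOf_inter_closedCell (hlf : X.IsLocallyFinite) {n : ℕ}
    (σ : X.Cell n) :
    {τ : (m : ℕ) × X.Cell m | (X.closedCell τ.2 ∩ X.closedCell σ).Nonempty}.Finite := by
  obtain ⟨A, hfin, -, hA⟩ := exists_closedCell_eq_iUnion σ
  choose p hp using fun ρ : (m : ℕ) × X.Cell m => X.openCell_nonempty ρ.2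
  refine (hfin.biUnion fun ρ _ => hlf (p ρ)).subset ?_
  rintro τ ⟨q, hqτ, hqσ⟩
  rw [hA] at hqσ
  obtain ⟨ρ, hρ, hq⟩ := Set.mem_iUnion₂.1 hqσ
  exact Set.mem_iUnion₂.2 ⟨ρ, hρ, openCell_subset_closedCell_of_mem hq hqτ (hp ρ)⟩

/-! ### Combinatorial balls -/

theorem mem_ball_succ {n : ℕ} {σ : X.Cell n} {k : ℕ} {p : X.Point} :
    p ∈ X.ball σ (k + 1) ↔ ∃ τ : (m : ℕ) × X.Cell m,
      (X.closedCell τ.2 ∩ X.ball σ k).Nonempty ∧ p ∈ X.closedCell τ.2 := by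
  simp only [ball, Set.mem_iUnion, exists_prop]
  rfl

theorem closedCell_subset_ball_succ {n : ℕ} {σ : X.Cell n} {k : ℕ} {τ : (m : ℕ) × X.Cell m}
    (h : (X.closedCell τ.2 ∩ X.ball σ k).Nonempty) : X.closedCell τ.2 ⊆ X.ball σ (k + 1) :=
  fun _ hp => mem_ball_succ.2 ⟨τ, h, hp⟩

theorem ball_subset_succ {n : ℕ} (σ : X.Cell n) (k : ℕ) : X.ball σ k ⊆ X.ball σ (k + 1) := by
  intro p hp
  obtain ⟨τ, hτ⟩ := X.exists_mem_closedCell p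
  exact closedCell_subset_ball_succ ⟨p, hτ, hp⟩ hτ

theorem ball_mono {n : ℕ} (σ : X.Cell n) : Monotone (X.ball σ) :=
  monotone_nat_of_le_succ (ball_subset_succ σ)

theorem IsLocallyFinite.finite_setOf_inter_ball (hlf : X.IsLocallyFinite) {n : ℕ}
    (σ : X.Cell n) (k : ℕ) :
    {τ : (m : ℕ) × X.Cell m | (X.closedCell τ.2 ∩ X.ball σ k).Nonempty}.Finite := by
  induction k with
  | zero => exact hlf.finite_setOf_inter_closedCell σ
  | succ k ih =>
    refine (ih.biUnion fun ρ _ => hlf.finite_setOf_inter_closedCell ρ.2).subset ?_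
    rintro τ ⟨q, hqτ, hq⟩
    obtain ⟨ρ, hρ, hqρ⟩ := mem_ball_succ.1 hq
    exact Set.mem_iUnion₂.2 ⟨ρ, hρ, q, hqτ, hqρ⟩

/-- Each closed cell lies in the union of the balls or misses it, so the union is clopen in the weak
topology. -/
theorem iUnion_ball_eq_univ (hconn : ConnectedSpace X.Point) {n : ℕ} (σ : X.Cell n) :
    ⋃ k, X.ball σ k = Set.univ := by
  have key : ∀ τ : (m : ℕ) × X.Cell m, X.charMap τ.2 ⁻¹' (⋃ k, X.ball σ k) = Set.univ ∨
      X.charMap τ.2 ⁻¹' (⋃ k, X.ball σ k) = ∅ := by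
    intro τ
    by_cases h : ∃ k, (X.closedCell τ.2 ∩ X.ball σ k).Nonempty
    · obtain ⟨k, hk⟩ := h
      left
      exact Set.eq_univ_of_forall fun x =>
        Set.mem_iUnion.2 ⟨k + 1, closedCell_subset_ball_succ hk ⟨x, rfl⟩⟩
    · right
      refine Set.eq_empty_of_forall_notMem fun x hx => h ?_
      obtain ⟨k, hk⟩ := Set.mem_iUnion.1 hx
      exact ⟨k, _, ⟨x, rfl⟩, hk⟩
  have hclopen : IsClopen (⋃ k, X.ball σ k) := by
    constructor
    · rw [← isOpen_compl_iff]
      refine isOpen_iSup_iff.2 fun τ => isOpen_coinduced.2 ?_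
      rw [Set.preimage_compl, isOpen_compl_iff]
      rcases key τ with h | h <;> rw [h]
      exacts [isClosed_univ, isClosed_empty]
    · refine isOpen_iSup_iff.2 fun τ => isOpen_coinduced.2 ?_
      rcases key τ with h | h <;> rw [h]
      exacts [isOpen_univ, isOpen_empty]
  refine hclopen.eq_univ ?_
  obtain ⟨p, hp⟩ := X.openCell_nonempty σ
  exact ⟨p, Set.mem_iUnion.2 ⟨0, X.openCell_subset_closedCell σ hp⟩⟩

theorem exists_closedCell_subset_ball (hconn : ConnectedSpace X.Point) {m n : ℕ} (σ : X.Cell n)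
    (τ : X.Cell m) : ∃ k, X.closedCell τ ⊆ X.ball σ k := by
  obtain ⟨p, hp⟩ := X.openCell_nonempty τ
  have h := Set.mem_univ p
  rw [← iUnion_ball_eq_univ hconn σ] at h
  obtain ⟨k, hk⟩ := Set.mem_iUnion.1 h
  exact ⟨k + 1, closedCell_subset_ball_succ (τ := ⟨m, τ⟩)
    ⟨p, X.openCell_subset_closedCell τ hp, hk⟩⟩

theorem exists_ball_subset_ball (hconn : ConnectedSpace X.Point) {m n : ℕ} (σ : X.Cell n)
    (τ : X.Cell m) (j : ℕ) : ∃ k, X.ball τ j ⊆ X.ball σ k := by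
  induction j with
  | zero => exact exists_closedCell_subset_ball hconn σ τ
  | succ j ih =>
    obtain ⟨k, hk⟩ := ih
    refine ⟨k + 1, fun p hp => ?_⟩
    obtain ⟨ρ, hρ, hp⟩ := mem_ball_succ.1 hp
    exact closedCell_subset_ball_succ (hρ.mono (Set.inter_subset_inter_right _ hk)) hp

theorem countable_cells (hpoly : X.IsPolygonal) (hconn : ConnectedSpace X.Point)
    (hlf : X.IsLocallyFinite) : Countable ((n : ℕ) × X.Cell n) := by
  obtain ⟨⟨σ⟩, -⟩ := hpoly
  rw [← Set.countable_univ_iff]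
  refine (Set.countable_iUnion fun k => (hlf.finite_setOf_inter_ball σ k).countable).mono ?_
  intro τ _
  obtain ⟨k, hk⟩ := exists_closedCell_subset_ball hconn σ τ.2
  obtain ⟨p, hp⟩ := X.openCell_nonempty τ.2
  have hp' := X.openCell_subset_closedCell τ.2 hp
  exact Set.mem_iUnion.2 ⟨k, p, hp', hk hp'⟩

theorem IsPolygonal.nonempty_cell_zero (hpoly : X.IsPolygonal) : Nonempty (X.Cell 0) := by
  have step : ∀ n, Nonempty (X.Cell (n + 1)) → Nonempty (X.Cell n) := by
    rintro n ⟨σ⟩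
    obtain ⟨F, hF⟩ := exists_isFacet (X.shape_isConvexPolyhedron σ)
    obtain ⟨τ, -⟩ := X.exists_facet_isom σ F hF
    exact ⟨τ⟩
  exact step 0 (step 1 hpoly.1)

/-! ### The action of the automorphism group -/

theorem carriesCell_smul (g : X.Aut) {n : ℕ} (σ : X.Cell n) :
    ∃ e : X.shape σ ≃ X.shape (g • σ), IsIsom e ∧
      ∀ x, g • X.charMap σ x = X.charMap (g • σ) (e x) :=
  g.2 n σ

theorem smul_mem_closedCell (g : X.Aut) {n : ℕ} {σ : X.Cell n} {p : X.Point}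
    (hp : p ∈ X.closedCell σ) : g • p ∈ X.closedCell (g • σ) := by
  obtain ⟨x, rfl⟩ := hp
  obtain ⟨e, -, he⟩ := carriesCell_smul g σ
  exact ⟨e x, (he x).symm⟩

theorem smul_mem_closedCell_iff (g : X.Aut) {n : ℕ} {σ : X.Cell n} {p : X.Point} :
    g • p ∈ X.closedCell (g • σ) ↔ p ∈ X.closedCell σ := by
  refine ⟨fun h => ?_, smul_mem_closedCell g⟩
  have := smul_mem_closedCell g⁻¹ h
  rwa [inv_smul_smul, inv_smul_smul] at this

theorem smul_mem_ball (g : X.Aut) {n : ℕ} {σ : X.Cell n} {k : ℕ} {p : X.Point}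
    (hp : p ∈ X.ball σ k) : g • p ∈ X.ball (g • σ) k := by
  induction k generalizing p with
  | zero => exact smul_mem_closedCell g hp
  | succ k ih =>
    obtain ⟨τ, ⟨q, hqτ, hq⟩, hp⟩ := mem_ball_succ.1 hp
    exact mem_ball_succ.2 ⟨⟨τ.1, g • τ.2⟩, ⟨g • q, smul_mem_closedCell g hqτ, ih hq⟩,
      smul_mem_closedCell g hp⟩

theorem smul_cell_eq_of_forall {g h : X.Aut} {n : ℕ} {σ : X.Cell n}
    (H : ∀ p ∈ X.closedCell σ, g • p = h • p) : g • σ = h • σ := by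
  refine closedCell_injective (Set.Subset.antisymm ?_ ?_)
  · intro p hp
    rw [← smul_inv_smul g p, smul_mem_closedCell_iff] at hp
    have := smul_mem_closedCell h hp
    rwa [← H _ hp, smul_inv_smul] at this
  · intro p hp
    rw [← smul_inv_smul h p, smul_mem_closedCell_iff] at hp
    have := smul_mem_closedCell g hp
    rwa [H _ hp, smul_inv_smul] at this

/-! ### The topology of the automorphism group -/

/-- The automorphisms that agree with `g` on a ball. -/
def agreeOn (g : X.Aut) {n : ℕ} (σ : X.Cell n) (k : ℕ) : Set X.Aut :=
  {h | ∀ p ∈ X.ball σ k, h • p = g • p}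

theorem isOpen_agreeOn (g : X.Aut) {n : ℕ} (σ : X.Cell n) (k : ℕ) : IsOpen (agreeOn g σ k) :=
  TopologicalSpace.isOpen_generateFrom_of_mem ⟨g, n, σ, k, rfl⟩

theorem agreeOn_mem_nhds (g : X.Aut) {n : ℕ} (σ : X.Cell n) (k : ℕ) : agreeOn g σ k ∈ nhds g :=
  (isOpen_agreeOn g σ k).mem_nhds fun _ _ => rfl

instance : IsTopologicalGroup X.Aut where
  continuous_mul := by
    refine continuous_generateFrom_iff.2 ?_
    rintro _ ⟨g, n, σ, k, rfl⟩
    refine isOpen_iff_mem_nhds.2 ?_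
    rintro ⟨a, b⟩ hab
    -- To control a'b' on the ball around σ, b' must agree with b there, and a' with a on the ball
    -- around b • σ.
    refine Filter.mem_of_superset
      (prod_mem_nhds (agreeOn_mem_nhds a (b • σ) k) (agreeOn_mem_nhds b σ k)) ?_
    rintro ⟨a', b'⟩ ⟨ha, hb⟩ p hp
    rw [← hab p hp]
    change (a' * b') • p = (a * b) • p
    rw [mul_smul, mul_smul, hb p hp]
    exact ha _ (smul_mem_ball b hp)
  continuous_inv := by
    refine continuous_generateFrom_iff.2 ?_
    rintro _ ⟨g, n, σ, k, rfl⟩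
    refine isOpen_iff_mem_nhds.2 fun a ha => ?_
    refine Filter.mem_of_superset (agreeOn_mem_nhds a (a⁻¹ • σ) k) fun a' ha' p hp => ?_
    rw [← ha p hp, inv_smul_eq_iff, ha' _ (smul_mem_ball a⁻¹ hp), smul_inv_smul]

theorem isOpen_setOf_smul_eq {n : ℕ} (σ τ : X.Cell n) : IsOpen {g : X.Aut | g • σ = τ} := by
  refine isOpen_iff_mem_nhds.2 fun g hg => ?_
  refine Filter.mem_of_superset (agreeOn_mem_nhds g σ 0) fun h hh => ?_
  exact (smul_cell_eq_of_forall hh).trans hg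

/-- Automorphisms fixing a cell have finitely many restrictions to each ball around it. -/
theorem exists_agreeOn_mem_ultrafilter (hlf : X.IsLocallyFinite) {n : ℕ} (σ : X.Cell n) (k : ℕ)
    (f : Ultrafilter X.Aut) (hf : {g : X.Aut | g • σ = σ} ∈ f) :
    ∃ g : X.Aut, g • σ = σ ∧ agreeOn g σ k ∈ f := by
  classical
  set N : Set ((m : ℕ) × X.Cell m) := {τ | (X.closedCell τ.2 ∩ X.ball σ k).Nonempty} with hN
  have hNfin : N.Finite := hlf.finite_setOf_inter_ball σ k
  have : Finite N := hNfin
  let Φ : X.Aut → (τ : N) → X.shape τ.1.2 → X.Point := fun g τ x => g • X.charMap τ.1.2 x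
  -- The possible restrictions to τ: an isometry onto the shape of some cell ρ of N followed by its
  -- characteristic map. The transport along h makes the dimensions of ρ and τ agree.
  let C : (τ : N) → Set (X.shape τ.1.2 → X.Point) := fun τ =>
    ⋃ ρ ∈ N, {φ | ∃ h : ρ.1 = τ.1.1, ∃ e : X.shape τ.1.2 ≃ X.shape (h ▸ ρ.2 : X.Cell τ.1.1),
      IsIsom e ∧ φ = fun x => X.charMap _ (e x)}
  have hCfin : ∀ τ, (C τ).Finite := by
    intro τ
    refine hNfin.biUnion fun ρ _ => ?_
    by_cases h : ρ.1 = τ.1.1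
    · refine ((finite_setOf_isIsom (X.shape_isConvexPolyhedron τ.1.2)
        (X.shape_isConvexPolyhedron (h ▸ ρ.2 : X.Cell τ.1.1))).image
          fun e x => X.charMap _ (e x)).subset ?_
      rintro φ ⟨_, e, he, rfl⟩
      exact ⟨e, he, rfl⟩
    · refine Set.finite_empty.subset ?_
      rintro φ ⟨h', -⟩
      exact h h'
  have hmaps : ∀ g ∈ {g : X.Aut | g • σ = σ}, Φ g ∈ Set.pi Set.univ C := by
    rintro g hg τ -
    obtain ⟨e, he, hge⟩ := carriesCell_smul g τ.1.2
    refine Set.mem_iUnion₂.2 ⟨⟨τ.1.1, g • τ.1.2⟩, ?_, rfl, e, he, funext hge⟩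
    obtain ⟨q, hq, hq'⟩ := τ.2
    have h1 := smul_mem_ball g hq'
    rw [show g • σ = σ from hg] at h1
    exact ⟨g • q, smul_mem_closedCell g hq, h1⟩
  -- An ultrafilter that contains a finite set is principal, so all restrictions coincide on a set
  -- of f.
  obtain ⟨φ, hφ, heq⟩ := Ultrafilter.eq_pure_of_finite_mem (f := f.map Φ)
    (Set.Finite.pi hCfin)
    (Ultrafilter.mem_map.2 (Filter.mem_of_superset hf hmaps))
  have h1 : Φ ⁻¹' {φ} ∈ f := by
    have : ({φ} : Set _) ∈ f.map Φ := by rw [heq]; exact Set.mem_singleton φ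
    exact this
  obtain ⟨g, hg, hgφ⟩ := f.nonempty_of_mem (Filter.inter_mem hf h1)
  refine ⟨g, hg, Filter.mem_of_superset h1 fun h hh p hp => ?_⟩
  obtain ⟨τ, hpτ⟩ := X.exists_mem_closedCell p
  have hτN : τ ∈ N := ⟨p, hpτ, hp⟩
  obtain ⟨x, rfl⟩ := hpτ
  have h2 : Φ h = Φ g := hh.trans hgφ.symm
  exact congrFun (congrFun h2 ⟨τ, hτN⟩) x

/-- A sequence of automorphisms fixing a cell, which is eventually constant on balls, converges. -/
theorem exists_limit (hconn : ConnectedSpace X.Point) {n : ℕ} {σ : X.Cell n} {g : ℕ → X.Aut}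
    (hσ : ∀ k, g k • σ = σ) (hg : ∀ j k, j ≤ k → g k ∈ agreeOn (g j) σ j) :
    ∃ h : X.Aut, ∀ k, h ∈ agreeOn (g k) σ k := by
  have hex : ∀ p : X.Point, ∃ k, p ∈ X.ball σ k := fun p => by
    have h := Set.mem_univ p
    rw [← iUnion_ball_eq_univ hconn σ] at h
    exact Set.mem_iUnion.1 h
  choose K hK using hex
  choose M hM using fun (m : ℕ) (τ : X.Cell m) => exists_closedCell_subset_ball hconn σ τ
  have hσ' : ∀ k, (g k)⁻¹ • σ = σ := fun k => by rw [inv_smul_eq_iff, hσ]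
  have hball : ∀ k j p, p ∈ X.ball σ k → g j • p ∈ X.ball σ k := fun k j p hp => by
    have := smul_mem_ball (g j) hp
    rwa [hσ] at this
  have hball' : ∀ k j p, p ∈ X.ball σ k → (g j)⁻¹ • p ∈ X.ball σ k := fun k j p hp => by
    have := smul_mem_ball (g j)⁻¹ hp
    rwa [hσ'] at this
  have hpt : ∀ i j p, p ∈ X.ball σ i → p ∈ X.ball σ j → g i • p = g j • p := by
    intro i j p hi hj
    rcases le_total i j with h | h
    · exact (hg i j h p hi).symm
    · exact hg j i h p hj
  have hpt' : ∀ i j p, p ∈ X.ball σ i → p ∈ X.ball σ j → (g i)⁻¹ • p = (g j)⁻¹ • p := by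
    intro i j p hi hj
    rw [inv_smul_eq_iff, hpt i j _ (hball' i j p hi) (hball' j j p hj), smul_inv_smul]
  have hcell : ∀ i j m (τ : X.Cell m), X.closedCell τ ⊆ X.ball σ i → X.closedCell τ ⊆ X.ball σ j →
      g i • τ = g j • τ := fun i j m τ hi hj =>
    smul_cell_eq_of_forall fun p hp => hpt i j p (hi hp) (hj hp)
  have hcell' : ∀ i j m (τ : X.Cell m), X.closedCell τ ⊆ X.ball σ i →
      X.closedCell τ ⊆ X.ball σ j → (g i)⁻¹ • τ = (g j)⁻¹ • τ := fun i j m τ hi hj =>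
    smul_cell_eq_of_forall fun p hp => hpt' i j p (hi hp) (hj hp)
  have hsub : ∀ k j m (τ : X.Cell m), X.closedCell τ ⊆ X.ball σ k →
      X.closedCell (g j • τ) ⊆ X.ball σ k := by
    intro k j m τ hτ p hp
    rw [← smul_inv_smul (g j) p, smul_mem_closedCell_iff] at hp
    rw [← smul_inv_smul (g j) p]
    exact hball k j _ (hτ hp)
  have hsub' : ∀ k j m (τ : X.Cell m), X.closedCell τ ⊆ X.ball σ k →
      X.closedCell ((g j)⁻¹ • τ) ⊆ X.ball σ k := by
    intro k j m τ hτ p hp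
    rw [← smul_inv_smul (g j)⁻¹ p, smul_mem_closedCell_iff] at hp
    rw [← smul_inv_smul (g j)⁻¹ p]
    exact hball' k j _ (hτ hp)
  -- Each point is moved by the automorphism belonging to a radius at which its ball contains the
  -- point; by `hpt` the radius does not matter. As every g k fixes σ, it preserves the balls, so
  -- the inverses glue in the same way.
  let φ : Equiv.Perm X.Point :=
    { toFun := fun p => g (K p) • p
      invFun := fun p => (g (K p))⁻¹ • p
      left_inv := fun p => by
        change (g (K (g (K p) • p)))⁻¹ • g (K p) • p = p
        rw [hpt' _ (K p) _ (hK _) (hball _ _ _ (hK p)), inv_smul_smul]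
      right_inv := fun p => by
        change g (K ((g (K p))⁻¹ • p)) • (g (K p))⁻¹ • p = p
        rw [hpt _ (K p) _ (hK _) (hball' _ _ _ (hK p)), smul_inv_smul] }
  let π : (m : ℕ) → Equiv.Perm (X.Cell m) := fun m =>
    { toFun := fun τ => g (M m τ) • τ
      invFun := fun τ => (g (M m τ))⁻¹ • τ
      left_inv := fun τ => by
        change (g (M m (g (M m τ) • τ)))⁻¹ • g (M m τ) • τ = τ
        rw [hcell' _ (M m τ) _ _ (hM _ _) (hsub _ _ _ _ (hM m τ)), inv_smul_smul]
      right_inv := fun τ => by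
        change g (M m ((g (M m τ))⁻¹ • τ)) • (g (M m τ))⁻¹ • τ = τ
        rw [hcell _ (M m τ) _ _ (hM _ _) (hsub' _ _ _ _ (hM m τ)), smul_inv_smul] }
  refine ⟨⟨(φ, π), fun m τ => ?_⟩, fun k p hp => ?_⟩
  · obtain ⟨e, he, hge⟩ := carriesCell_smul (g (M m τ)) τ
    refine ⟨e, he, fun x => ?_⟩
    exact (hpt _ _ _ (hK _) (hM m τ ⟨x, rfl⟩)).trans (hge x)
  · exact hpt _ _ _ (hK p) hp

/-- Stabilisers of cells are compact. -/
theorem isCompact_setOf_smul_eq_self (hconn : ConnectedSpace X.Point) (hlf : X.IsLocallyFinite)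
    {n : ℕ} (σ : X.Cell n) : IsCompact {g : X.Aut | g • σ = σ} := by
  rw [isCompact_iff_ultrafilter_le_nhds']
  intro f hf
  -- For every radius k the ultrafilter concentrates on automorphisms that agree with one g k. Any
  -- two of these sets of f intersect, so the g k are compatible and have a limit.
  choose g hgσ hgf using fun k => exists_agreeOn_mem_ultrafilter hlf σ k f hf
  obtain ⟨h, hh⟩ := exists_limit hconn hgσ fun j k hjk => by
    obtain ⟨a, ha, ha'⟩ := f.nonempty_of_mem (Filter.inter_mem (hgf j) (hgf k))
    intro p hp
    rw [← ha p hp, ha' p (ball_mono σ hjk hp)]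
  refine ⟨h, (smul_cell_eq_of_forall (hh 0)).trans (hgσ 0), ?_⟩
  rw [TopologicalSpace.nhds_generateFrom]
  refine le_iInf₂ ?_
  rintro _ ⟨hmem, a, m, τ, j, rfl⟩
  obtain ⟨k, hk⟩ := exists_ball_subset_ball hconn σ τ j
  rw [Filter.le_principal_iff]
  refine Filter.mem_of_superset (hgf k) fun b hb p hp => ?_
  rw [hb p (hk hp), ← hh k p (hk hp)]
  exact hmem p hp

end PolyhedralComplex

/-! ### Covolumes of discrete subgroups -/

section Covolume

open scoped Pointwise

variable {G : Type*} [Group G]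

theorem tsum_eq_tsum_quotient_tsum_orbit {Γ S : Type*} [Group Γ] [MulAction Γ S] (F : S → ℝ≥0∞) :
    ∑' t, F t = ∑' q : Quotient (MulAction.orbitRel Γ S),
      ∑' t : MulAction.orbit Γ q.out, F t.1 := by
  rw [← (MulAction.selfEquivSigmaOrbits Γ S).symm.tsum_eq F, ENNReal.tsum_sigma']
  rfl

/-- Orbit–stabiliser: the sum over Γ meets each point of the orbit once for every element of the
stabiliser. Infinite stabilisers are allowed. -/
theorem tsum_smul_eq_card_mul_tsum_orbit {Γ S : Type*} [Group Γ] [MulAction Γ S] (F : S → ℝ≥0∞)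
    (s : S) : ∑' γ : Γ, F (γ • s)
      = (ENat.card (MulAction.stabilizer Γ s) : ℕ∞) * ∑' t : MulAction.orbit Γ s, F t.1 := by
  have h : ∀ γ : Γ, F (γ • s)
      = F ((MulAction.orbitProdStabilizerEquivGroup Γ s).symm γ).1.1 := fun γ => rfl
  simp_rw [h]
  rw [(MulAction.orbitProdStabilizerEquivGroup Γ s).symm.tsum_eq
    (fun x : MulAction.orbit Γ s × MulAction.stabilizer Γ s => F x.1.1),
    ENNReal.tsum_prod (f := fun (t : MulAction.orbit Γ s) (_ : MulAction.stabilizer Γ s) => F t.1)]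
  simp_rw [ENNReal.tsum_const]
  rw [ENNReal.tsum_mul_left]

variable [TopologicalSpace G] [IsTopologicalGroup G]

theorem countable_of_discrete_subgroup [T2Space G] [LindelofSpace G] (Γ : Subgroup G)
    [DiscreteTopology Γ] : Countable Γ := by
  have : LindelofSpace Γ :=
    isLindelof_iff_lindelofSpace.1 (Subgroup.isClosed_of_discrete (H := Γ)).isLindelof
  exact countable_of_Lindelof_of_discrete

variable [MeasurableSpace G] [BorelSpace G]

/-- For a countable `G`-set `S` with open stabilisers of finite positive measure, the sum of the
`1 / |Γ_s|` over the `Γ`-orbits is the covolume of `Γ` times the sum of the `1 / μ(G_s)` over the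
`G`-orbits. -/
theorem tsum_inv_card_stabilizer_eq {μ : Measure G} [μ.IsMulLeftInvariant] {Γ : Subgroup G}
    [Countable Γ] {D : Set G} (hD : IsFundamentalDomain Γ D μ) {S : Type*} [MulAction G S]
    [Countable S] (hopen : ∀ s t : S, IsOpen {g : G | g • s = t})
    (h0 : ∀ s : S, μ {g | g • s = s} ≠ 0) (htop : ∀ s : S, μ {g | g • s = s} ≠ ∞) :
    ∑' q : Quotient (MulAction.orbitRel Γ S),
        ((ENat.card (MulAction.stabilizer Γ q.out) : ℕ∞) : ℝ≥0∞)⁻¹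
      = μ D * ∑' i : Quotient (MulAction.orbitRel G S), (μ {g | g • i.out = i.out})⁻¹ := by
  let w : Quotient (MulAction.orbitRel G S) → ℝ≥0∞ := fun i => (μ {g | g • i.out = i.out})⁻¹
  -- The mass that t receives when D is pushed to S by the orbit maps, weighted so that the sum over
  -- Γ is 1.
  let F : S → ℝ≥0∞ := fun t => ∑' i, w i * μ ({g | g • i.out = t} ∩ D)
  -- The Γ-translates of D tile G, so the pieces add up to μ {g | g • i.out = t}. This set is empty
  -- unless i is the orbit of t, and then it is a left translate of the stabiliser of i.out.
  have hF : ∀ t, ∑' γ : Γ, F (γ • t) = 1 := by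
    intro t
    simp only [F]
    rw [ENNReal.tsum_comm]
    have h1 : ∀ i, ∑' γ : Γ, w i * μ ({g | g • i.out = γ • t} ∩ D)
        = w i * μ {g | g • i.out = t} := by
      intro i
      rw [ENNReal.tsum_mul_left, hD.measure_eq_tsum]
      congr 1
      refine tsum_congr fun γ => ?_
      congr 2
      ext g
      rw [Set.mem_smul_set_iff_inv_smul_mem, Set.mem_ofPred_eq, Set.mem_ofPred_eq,
        Subgroup.smul_def, Subgroup.smul_def, smul_eq_mul, mul_smul, Subgroup.coe_inv,
        inv_smul_eq_iff]
    simp_rw [h1]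
    have hdiff : ∀ i, i ≠ Quotient.mk (MulAction.orbitRel G S) t →
        w i * μ {g | g • i.out = t} = 0 := by
      intro i hi
      have : {g : G | g • i.out = t} = ∅ := by
        refine Set.eq_empty_of_forall_notMem fun g hg => hi ?_
        rw [← Quotient.out_eq i]
        exact (Quotient.sound (s := MulAction.orbitRel G S)
          (MulAction.orbitRel_apply.2 ⟨g, hg⟩)).symm
      rw [this, measure_empty, mul_zero]
    rw [tsum_eq_single _ hdiff]
    set i := Quotient.mk (MulAction.orbitRel G S) t
    obtain ⟨g₀, hg₀⟩ : ∃ g : G, g • i.out = t := by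
      have h2 : (MulAction.orbitRel G S).r t i.out :=
        Quotient.exact (Quotient.out_eq i).symm
      exact MulAction.orbitRel_apply.1 h2
    have h3 : μ {g | g • i.out = t} = μ {g | g • i.out = i.out} := by
      rw [← measure_preimage_mul μ g₀ {g | g • i.out = t}]
      congr 1
      ext g
      rw [Set.mem_preimage, Set.mem_ofPred_eq, Set.mem_ofPred_eq, mul_smul]
      exact (Eq.congr_right hg₀.symm).trans (smul_left_cancel_iff g₀)
    rw [h3]
    exact ENNReal.inv_mul_cancel (h0 _) (htop _)
  calc ∑' q : Quotient (MulAction.orbitRel Γ S),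
        ((ENat.card (MulAction.stabilizer Γ q.out) : ℕ∞) : ℝ≥0∞)⁻¹
      = ∑' q : Quotient (MulAction.orbitRel Γ S), ∑' t : MulAction.orbit Γ q.out, F t.1 := by
        refine tsum_congr fun q => ?_
        have h := hF q.out
        rw [tsum_smul_eq_card_mul_tsum_orbit, mul_comm] at h
        exact (ENNReal.eq_inv_of_mul_eq_one_left h).symm
    _ = ∑' t, F t := (tsum_eq_tsum_quotient_tsum_orbit F).symm
    _ = ∑' i, ∑' t : S, w i * μ ({g | g • i.out = t} ∩ D) := ENNReal.tsum_comm
    _ = ∑' i, w i * μ D := by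
        refine tsum_congr fun i => ?_
        rw [ENNReal.tsum_mul_left]
        congr 1
        -- For fixed i the sets {g | g • i.out = t} partition G, so their traces on D add up to μ D.
        have hmeas : ∀ t : S, MeasurableSet {g : G | g • i.out = t} :=
          fun t => (hopen _ t).measurableSet
        have h1 : ⋃ t : S, {g : G | g • i.out = t} = Set.univ :=
          Set.eq_univ_of_forall fun g => Set.mem_iUnion.2 ⟨g • i.out, rfl⟩
        rw [← Measure.restrict_apply_univ D, ← h1, measure_iUnion _ hmeas]
        · exact tsum_congr fun t => (Measure.restrict_apply (hmeas t)).symm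
        · intro t t' hne
          exact Set.disjoint_left.2 fun g hg hg' => hne (Eq.trans (Eq.symm hg) hg')
    _ = _ := by rw [ENNReal.tsum_mul_right, mul_comm]

/-- A discrete subgroup has a Borel fundamental domain. -/
theorem exists_isFundamentalDomain_of_discrete [LindelofSpace G] (μ : Measure G) (Γ : Subgroup G)
    [DiscreteTopology Γ] : ∃ D : Set G, IsFundamentalDomain Γ D μ := by
  classical
  obtain ⟨U, hU, hUΓ⟩ : ∃ U : Set G, IsOpen U ∧ Subtype.val ⁻¹' U = ({1} : Set Γ) :=
    isOpen_induced_iff.1 (isOpen_discrete ({1} : Set Γ))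
  have hU1 : U ∈ nhds ((1 : G) * (1 : G)⁻¹) := by
    rw [inv_one, mul_one]
    refine hU.mem_nhds ?_
    have : (1 : Γ) ∈ Subtype.val ⁻¹' U := by rw [hUΓ]; rfl
    exact this
  have hcont : ContinuousAt (fun p : G × G => p.1 * p.2⁻¹) (1, 1) := by fun_prop
  obtain ⟨A, hA, B, hB, hAB⟩ := mem_nhds_prod_iff.1 (hcont.preimage_mem_nhds hU1)
  -- Since W W⁻¹ lies in U and U meets Γ only in 1, each right translate of W contains at most one
  -- point of every Γ-orbit.
  obtain ⟨W, hWsub, hWopen, hW1⟩ := mem_nhds_iff.1 (Filter.inter_mem hA hB)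
  have hWW : ∀ a ∈ W, ∀ b ∈ W, a * b⁻¹ ∈ U := fun a ha b hb =>
    hAB (Set.mk_mem_prod (hWsub ha).1 (hWsub hb).2)
  let V : G → Set G := fun x => {y | y * x⁻¹ ∈ W}
  have hVopen : ∀ x, IsOpen (V x) := fun x => hWopen.preimage (continuous_mul_const x⁻¹)
  have hVx : ∀ x, x ∈ V x := fun x => by
    change x * x⁻¹ ∈ W
    rwa [mul_inv_cancel]
  have hVinj : ∀ x y (γ : Γ), y ∈ V x → γ • y ∈ V x → γ = 1 := by
    intro x y γ hy hγ
    have h1 := hWW _ hγ _ hy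
    have h2 : (γ • y) * x⁻¹ * (y * x⁻¹)⁻¹ = (γ : G) := by
      rw [Subgroup.smul_def, smul_eq_mul]; group
    rw [h2] at h1
    have h3 : γ ∈ Subtype.val ⁻¹' U := h1
    rwa [hUΓ] at h3
  obtain ⟨t, ht, htU⟩ := LindelofSpace.elim_nhds_subcover V
    fun x => (hVopen x).mem_nhds (hVx x)
  have htne : t.Nonempty := by
    have h1 := Set.mem_univ (1 : G)
    rw [← htU] at h1
    obtain ⟨x, hx, -⟩ := Set.mem_iUnion₂.1 h1
    exact ⟨x, hx⟩
  obtain ⟨f, rfl⟩ := ht.exists_eq_range htne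
  have hcover : ∀ y, ∃ i, y ∈ V (f i) := fun y => by
    have h1 := Set.mem_univ y
    rw [← htU, Set.biUnion_range] at h1
    exact Set.mem_iUnion.1 h1
  let O : ℕ → Set G := fun i => ⋃ γ : Γ, {y | γ • y ∈ V (f i)}
  have hO : ∀ i, IsOpen (O i) := fun i =>
    isOpen_iUnion fun γ => (hVopen (f i)).preimage (continuous_const_smul γ)
  have hOsmul : ∀ i y (γ : Γ), γ • y ∈ O i ↔ y ∈ O i := by
    intro i y γ
    simp only [O, Set.mem_iUnion, Set.mem_ofPred_eq]
    constructor
    · rintro ⟨δ, h⟩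
      exact ⟨δ * γ, by rwa [mul_smul]⟩
    · rintro ⟨δ, h⟩
      exact ⟨δ * γ⁻¹, by rwa [mul_smul, inv_smul_smul]⟩
  have hVO : ∀ i y, y ∈ V (f i) → y ∈ O i := fun i y hy =>
    Set.mem_iUnion.2 ⟨1, by rwa [Set.mem_ofPred_eq, one_smul]⟩
  -- An orbit is represented in the first V (f i) that it meets; the Γ-saturations O j of the
  -- earlier ones are removed.
  refine ⟨⋃ i, V (f i) \ ⋃ j ∈ Set.Iio i, O j, IsFundamentalDomain.mk' ?_ fun x => ?_⟩
  · refine (MeasurableSet.iUnion fun i => (hVopen (f i)).measurableSet.diff ?_).nullMeasurableSet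
    exact (isOpen_biUnion fun j _ => hO j).measurableSet
  · have hex : ∃ i, x ∈ O i := (hcover x).imp fun i hi => hVO i x hi
    obtain ⟨γ, hγ⟩ := Set.mem_iUnion.1 (Nat.find_spec hex)
    refine ⟨γ, Set.mem_iUnion.2 ⟨Nat.find hex, hγ, fun hmem => ?_⟩, fun δ hδ => ?_⟩
    · obtain ⟨j, hj, hxj⟩ := Set.mem_iUnion₂.1 hmem
      exact Nat.find_min hex hj ((hOsmul j x γ).1 hxj)
    · obtain ⟨i, hi, hnot⟩ := Set.mem_iUnion.1 hδ
      have hxi : x ∈ O i := (hOsmul i x δ).1 (hVO i _ hi)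
      have hieq : i = Nat.find hex := by
        refine le_antisymm (not_lt.1 fun hlt => hnot ?_) (Nat.find_min' hex hxi)
        exact Set.mem_iUnion₂.2 ⟨_, hlt, (hOsmul _ x δ).2 (Nat.find_spec hex)⟩
      subst hieq
      have h1 : (δ * γ⁻¹) • γ • x ∈ V (f (Nat.find hex)) := by
        rwa [mul_smul, inv_smul_smul]
      exact mul_inv_eq_one.1 (hVinj _ _ _ hγ h1)

/-- Some compact C maps onto Γ\G. Its translates cover D, and the measures of γC ∩ D sum to μ(C). -/
theorem measure_fundamentalDomain_ne_top [LocallyCompactSpace G] {μ : Measure G}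
    [μ.IsHaarMeasure] {Γ : Subgroup G} [Countable Γ]
    [CompactSpace (Quotient (MulAction.orbitRel Γ G))] {D : Set G}
    (hD : IsFundamentalDomain Γ D μ) : μ D ≠ ∞ := by
  have hK : ∀ x : G, ∃ K : Set G, IsCompact K ∧ K ∈ nhds x := fun x => exists_compact_mem_nhds x
  choose K hKc hKx using hK
  obtain ⟨t, ht⟩ := CompactSpace.elim_nhds_subcover
    (fun q : Quotient (MulAction.orbitRel Γ G) =>
      Quotient.mk (MulAction.orbitRel Γ G) '' K q.out) (fun q => by
        have h := (isOpenMap_quotient_mk'_mul (Γ := Γ) (T := G)).image_mem_nhds (hKx q.out)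
        convert h using 2
        · exact (Quotient.out_eq q).symm
        · rfl)
  let C : Set G := ⋃ q ∈ t, K q.out
  have hC : IsCompact C := t.isCompact_biUnion fun q _ => hKc q.out
  have hcover : D ⊆ ⋃ γ : Γ, γ • C ∩ D := by
    intro x hx
    have h1 : Quotient.mk (MulAction.orbitRel Γ G) x ∈
        (⊤ : Set (Quotient (MulAction.orbitRel Γ G))) := trivial
    rw [← ht] at h1
    obtain ⟨q, hq, y, hy, hxy⟩ := Set.mem_iUnion₂.1 h1
    have h2 : (MulAction.orbitRel Γ G).r x y := Quotient.exact hxy.symm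
    obtain ⟨γ, hγ⟩ := MulAction.orbitRel_apply.1 h2
    exact Set.mem_iUnion.2 ⟨γ, ⟨y, Set.mem_iUnion₂.2 ⟨q, hq, hy⟩, hγ⟩, hx⟩
  refine ne_top_of_le_ne_top (hC.measure_lt_top (μ := μ)).ne ?_
  rw [hD.measure_eq_tsum C]
  exact (measure_mono hcover).trans (measure_iUnion_le _)

end Covolume

/-! ### Haar measure on Aut(X) and the weights of orbits of cells -/

namespace PolyhedralComplex

variable {κ : Geometry} {X : PolyhedralComplex.{u, v} κ}

theorem Aut.ext_of_smul_eq {g h : X.Aut} (H : ∀ p : X.Point, g • p = h • p) : g = h := by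
  refine Subtype.ext (Prod.ext (Equiv.ext H) (funext fun n => Equiv.ext fun σ => ?_))
  exact smul_cell_eq_of_forall (g := g) (h := h) fun p _ => H p

instance : T2Space X.Aut := by
  refine ⟨fun g h hne => ?_⟩
  obtain ⟨p, hp⟩ : ∃ p : X.Point, g • p ≠ h • p := by
    by_contra! H
    exact hne (Aut.ext_of_smul_eq H)
  obtain ⟨τ, hτ⟩ := X.exists_mem_closedCell p
  refine ⟨agreeOn g τ.2 0, agreeOn h τ.2 0, isOpen_agreeOn _ _ _, isOpen_agreeOn _ _ _,
    fun _ _ => rfl, fun _ _ => rfl, Set.disjoint_left.2 fun f hf hf' => hp ?_⟩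
  exact (hf p hτ).symm.trans (hf' p hτ)

theorem isOpen_stabilizer {n : ℕ} (σ : X.Cell n) : IsOpen {g : X.Aut | g • σ = σ} :=
  isOpen_setOf_smul_eq σ σ

theorem locallyCompactSpace_aut (hpoly : X.IsPolygonal) (hconn : ConnectedSpace X.Point)
    (hlf : X.IsLocallyFinite) : LocallyCompactSpace X.Aut := by
  obtain ⟨⟨σ⟩, -⟩ := hpoly
  exact (isCompact_setOf_smul_eq_self hconn hlf σ).locallyCompactSpace_of_mem_nhds_of_group
    ((isOpen_stabilizer σ).mem_nhds (one_smul X.Aut σ))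

/-- Aut(X) is a countable union of cosets of the compact stabiliser of a face. The resulting
Lindelöf property makes discrete subgroups countable and gives them fundamental domains. -/
theorem sigmaCompactSpace_aut (hpoly : X.IsPolygonal) (hconn : ConnectedSpace X.Point)
    (hlf : X.IsLocallyFinite) : SigmaCompactSpace X.Aut := by
  have := countable_cells hpoly hconn hlf
  obtain ⟨⟨σ⟩, -⟩ := hpoly
  have : Countable (X.Cell 2) :=
    Function.Injective.countable (f := fun τ : X.Cell 2 => (⟨2, τ⟩ : (n : ℕ) × X.Cell n))
      sigma_mk_injective
  refine SigmaCompactSpace.of_countable (Set.range fun τ : X.Cell 2 => {g : X.Aut | g • σ = τ})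
    (Set.countable_range _) ?_ ?_
  · rintro _ ⟨τ, rfl⟩
    rcases Set.eq_empty_or_nonempty {g : X.Aut | g • σ = τ} with h | ⟨a, ha⟩
    · dsimp only
      rw [h]
      exact isCompact_empty
    · convert (isCompact_setOf_smul_eq_self hconn hlf σ).image (continuous_const_mul a) using 1
      ext g
      constructor
      · intro hg
        refine ⟨a⁻¹ * g, ?_, mul_inv_cancel_left a g⟩
        rw [Set.mem_ofPred_eq, mul_smul, inv_smul_eq_iff]
        exact Eq.trans hg (Eq.symm ha)
      · rintro ⟨b, hb, rfl⟩
        change (a * b) • σ = τ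
        rw [mul_smul, show b • σ = σ from hb]
        exact ha
  · exact Set.eq_univ_of_forall fun g => ⟨_, ⟨g • σ, rfl⟩, rfl⟩

/-- The sum of `1 / μ(G_σ)` over the `G`-orbits of `n`-cells `σ`. -/
noncomputable def orbitWeight (μ : Measure X.Aut) (n : ℕ) : ℝ≥0∞ :=
  ∑' i : Quotient (MulAction.orbitRel X.Aut (X.Cell n)), (μ {g | g • i.out = i.out})⁻¹

theorem orbitWeight_smul (μ : Measure X.Aut) (n : ℕ) {c : ℝ≥0∞} (h0 : c ≠ 0) (ht : c ≠ ∞) :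
    orbitWeight (c • μ) n = c⁻¹ * orbitWeight μ n := by
  rw [orbitWeight, orbitWeight, ← ENNReal.tsum_mul_left]
  refine tsum_congr fun i => ?_
  rw [Measure.smul_apply, smul_eq_mul, ENNReal.mul_inv (Or.inl h0) (Or.inl ht)]

theorem measure_stabilizer_ne_top (hconn : ConnectedSpace X.Point) (hlf : X.IsLocallyFinite)
    (μ : Measure X.Aut) [μ.IsHaarMeasure] {n : ℕ} (σ : X.Cell n) : μ {g | g • σ = σ} ≠ ∞ :=
  (isCompact_setOf_smul_eq_self hconn hlf σ).measure_lt_top.ne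

theorem measure_stabilizer_ne_zero (μ : Measure X.Aut) [μ.IsHaarMeasure] {n : ℕ} (σ : X.Cell n) :
    μ {g | g • σ = σ} ≠ 0 :=
  (isOpen_stabilizer σ).measure_ne_zero μ ⟨1, one_smul X.Aut σ⟩

theorem orbitWeight_ne_top (hfin : X.HasFiniteQuotient) (μ : Measure X.Aut) [μ.IsHaarMeasure]
    (n : ℕ) : orbitWeight μ n ≠ ∞ := by
  have := hfin n
  have := Fintype.ofFinite (Quotient (MulAction.orbitRel X.Aut (X.Cell n)))
  rw [orbitWeight, tsum_fintype]
  exact ENNReal.sum_ne_top.2 fun i _ => ENNReal.inv_ne_top.2 (measure_stabilizer_ne_zero μ _)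

theorem orbitWeight_ne_zero (hconn : ConnectedSpace X.Point) (hlf : X.IsLocallyFinite)
    (μ : Measure X.Aut) [μ.IsHaarMeasure] {n : ℕ} (hn : Nonempty (X.Cell n)) :
    orbitWeight μ n ≠ 0 := by
  obtain ⟨σ⟩ := hn
  intro h
  exact ENNReal.inv_ne_zero.2 (measure_stabilizer_ne_top hconn hlf μ _)
    (ENNReal.tsum_eq_zero.1 h (Quotient.mk _ σ))

/-- The covolume formula for the action on `n`-cells, with the finiteness of covolumes of uniform
lattices. -/
theorem IsUniformLattice.setCovolume_eq (hpoly : X.IsPolygonal) (hconn : ConnectedSpace X.Point)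
    (hlf : X.IsLocallyFinite) (μ : Measure X.Aut) [μ.IsHaarMeasure] {Γ : Subgroup X.Aut}
    (hΓ : IsUniformLattice Γ) :
    covolume Γ X.Aut μ ≠ 0 ∧ covolume Γ X.Aut μ ≠ ∞ ∧
      ∀ n, setCovolume Γ (X.Cell n) = covolume Γ X.Aut μ * orbitWeight μ n := by
  have := hΓ.1
  have := hΓ.2
  have := locallyCompactSpace_aut hpoly hconn hlf
  have := sigmaCompactSpace_aut hpoly hconn hlf
  have := countable_of_discrete_subgroup Γ
  have := countable_cells hpoly hconn hlf
  obtain ⟨D, hD⟩ := exists_isFundamentalDomain_of_discrete μ Γ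
  rw [hD.covolume_eq_volume μ]
  refine ⟨hD.measure_ne_zero (NeZero.ne μ), measure_fundamentalDomain_ne_top hD, fun n => ?_⟩
  have : Countable (X.Cell n) :=
    Function.Injective.countable (f := fun τ : X.Cell n => (⟨n, τ⟩ : (n : ℕ) × X.Cell n))
      sigma_mk_injective
  exact tsum_inv_card_stabilizer_eq hD isOpen_setOf_smul_eq (measure_stabilizer_ne_zero μ)
    (measure_stabilizer_ne_top hconn hlf μ)

/-- The weights see only the measures of open sets, on which two Haar measures are proportional
without any regularity assumption. The factor c is the same for all n. -/
theorem orbitWeight_eq_of_isHaarMeasure [LocallyCompactSpace X.Aut] (μ ν : Measure X.Aut)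
    [μ.IsHaarMeasure] [ν.IsHaarMeasure] :
    ∃ c : ℝ≥0∞, ∀ n, orbitWeight μ n = c * orbitWeight ν n := by
  have h0 : (μ.haarScalarFactor ν : ℝ≥0∞) ≠ 0 :=
    ENNReal.coe_ne_zero.2 (Measure.haarScalarFactor_pos_of_isHaarMeasure μ ν).ne'
  refine ⟨(μ.haarScalarFactor ν : ℝ≥0∞)⁻¹, fun n => ?_⟩
  rw [← orbitWeight_smul ν n h0 ENNReal.coe_ne_top, orbitWeight, orbitWeight]
  refine tsum_congr fun i => ?_
  rw [Measure.measure_isHaarMeasure_eq_smul_of_isOpen μ ν (isOpen_stabilizer i.out)]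
  rfl

end PolyhedralComplex

theorem corollary4p2 {κ : Geometry} (X : PolyhedralComplex.{u, v} κ)
    (hpoly : X.IsPolygonal) (hconn : ConnectedSpace X.Point) (hlf : X.IsLocallyFinite)
    (hfin : X.HasFiniteQuotient) :
    (∃ μ : Measure X.Aut, PolyhedralComplex.IsNormalizedHaar μ) ∧
    ∃ c : ℝ≥0, 0 < c ∧
      ∀ μ : Measure X.Aut, PolyhedralComplex.IsNormalizedHaar μ →
        ∀ Γ : Subgroup X.Aut, PolyhedralComplex.IsUniformLattice Γ →
          PolyhedralComplex.ActsWithoutInversions Γ →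
            covolume Γ X.Aut μ = (c : ℝ≥0∞) * PolyhedralComplex.setCovolume Γ (X.Cell 2) := by
  have := PolyhedralComplex.locallyCompactSpace_aut hpoly hconn hlf
  obtain ⟨μ₀, hμ₀⟩ : ∃ μ₀ : Measure X.Aut, μ₀.IsHaarMeasure := ⟨Measure.haar, inferInstance⟩
  have hv0 := PolyhedralComplex.orbitWeight_ne_zero hconn hlf μ₀ hpoly.nonempty_cell_zero
  have hvt := PolyhedralComplex.orbitWeight_ne_top hfin μ₀ 0
  -- Weights scale inversely to the measure, so multiplying μ₀ by its own vertex weight makes the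
  -- vertex weight 1.
  set ν : Measure X.Aut := PolyhedralComplex.orbitWeight μ₀ 0 • μ₀ with hν
  have hνH : ν.IsHaarMeasure := Measure.IsHaarMeasure.smul μ₀ hv0 hvt
  have hν1 : PolyhedralComplex.orbitWeight ν 0 = 1 := by
    rw [hν, PolyhedralComplex.orbitWeight_smul μ₀ 0 hv0 hvt, ENNReal.inv_mul_cancel hv0 hvt]
  refine ⟨⟨ν, hνH, fun Γ hΓ => ?_⟩, ?_⟩
  · rw [(hΓ.setCovolume_eq hpoly hconn hlf ν).2.2 0, hν1, mul_one]
  have hf0 := PolyhedralComplex.orbitWeight_ne_zero hconn hlf ν hpoly.1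
  have hft := PolyhedralComplex.orbitWeight_ne_top hfin ν 2
  refine ⟨(PolyhedralComplex.orbitWeight ν 2)⁻¹.toNNReal,
    ENNReal.toNNReal_pos (ENNReal.inv_ne_zero.2 hft) (ENNReal.inv_ne_top.2 hf0), ?_⟩
  intro μ hμ Γ hΓ _
  have := hμ.1
  obtain ⟨h0, ht, hcov⟩ := hΓ.setCovolume_eq hpoly hconn hlf μ
  -- The normalisation at Γ, whose covolume is finite and nonzero, forces vertex weight 1. Hence μ
  -- and ν have proportionality factor 1 and equal face weights.
  have hμ1 : PolyhedralComplex.orbitWeight μ 0 = 1 := by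
    have h1 := (hμ.2 Γ hΓ).trans (hcov 0)
    rw [← ENNReal.mul_right_inj h0 ht, mul_one]
    exact h1.symm
  obtain ⟨c, hc⟩ := PolyhedralComplex.orbitWeight_eq_of_isHaarMeasure μ ν
  have hc1 : c = 1 := by
    have := hc 0
    rw [hμ1, hν1, mul_one] at this
    exact this.symm
  rw [ENNReal.coe_toNNReal (ENNReal.inv_ne_top.2 hf0), hcov 2, hc 2, hc1, one_mul, mul_left_comm,
    ENNReal.inv_mul_cancel hf0 hft, mul_one]
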